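/- Let $k\ge 1$ and $q=e^{2\pi i/k}$. A Borel probability measure $\nu$ on $\mathbb{C}$ is called $k$-symmetric if it is concentrated on the semiaxes $\{tq^s : t\ge 0,\ s\in\mathbb{N}\}$ and $\nu(qB)=\nu(B)$ for every Borel set $B$. A positive measure is a Borel probability measure concentrated on $[0,\infty)$, regarded as a measure on $\mathbb{C}$; equivalently, it is a $1$-symmetric measure. A non-commutative probability space $(\mathcal{A},\varphi)$ is a unital complex algebra with a linear functional $\varphi$ such that $\varphi(1)=1$. An element $X\in\mathcal{A}$ has the moments of a measure $\rho$ on $\mathbb C$ if $\int |z|^n\,d\rho<\infty$ and $\varphi(X^n)=\int z^n\,d\rho(z)$ for all $n\ge 0$. Elements $X,Y$ are free if $\varphi(a_1\cdots a_n)=0$ for all $n\ge1$ whenever $\varphi(a_j)=0$ for all $j$ and the $a_j$ belong alternately to the unital algebras generated by $X$ and by $Y$. Let $\mu$ be a positive measure and $\nu$ a $k$-symmetric measure, both with bounded support. Then the free multiplicative convolution $\mu\boxtimes\nu$ is well defined. Namely, there is exactly one $k$-symmetric measure $\rho$ which has the moments of $XY$ for some free elements $X,Y$ of some non-commutative probability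 space having the moments of $\mu$ and of $\nu$, respectively. This measure, denoted by $\mu\boxtimes\nu$, has bounded support, and it does not depend on the choice of $X$ and $Y$: for every non-commutative probability space and all free elements $X,Y$ of it having the moments of $\mu$ and $\nu$, the measure $\mu\boxtimes\nu$ is the unique $k$-symmetric measure with the moments of $XY$. Moreover $$(\mu\boxtimes\nu)^k=\mu^{\boxtimes k}\boxtimes\nu^k,$$ where $\rho^k$ denotes the push-forward of $\rho$ under $t\mapsto t^k$, $\mu^{\boxtimes 1}=\mu$, $\mu^{\boxtimes (n+1)}=\mu^{\boxtimes n}\boxtimes\mu$, and the convolution of positive measures is the case $k=1$ of the above. -/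

import Mathlib

open MeasureTheory

noncomputable section

/-- The primitive `k`-th root of unity `q = exp (2 π i / k)`. -/
def rootOfUnity (k : ℕ) : ℂ := Complex.exp (2 * Real.pi * Complex.I / k)

/-- The `k` closed semiaxes `A_k = {t q ^ s : t ≥ 0, s ∈ ℕ}` in the complex plane. -/
def semiaxes (k : ℕ) : Set ℂ :=
  {z | ∃ t : ℝ, 0 ≤ t ∧ ∃ s : ℕ, z = (t : ℂ) * rootOfUnity k ^ s}

/-- `k`-symmetric measures: Borel probability measures on `ℂ` which are concentrated on the
`k` semiaxes and invariant under multiplication by `q`. -/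
structure IsKSymmetric (k : ℕ) (ν : Measure ℂ) : Prop where
  isProbabilityMeasure : IsProbabilityMeasure ν
  ae_mem_semiaxes : ∀ᵐ z ∂ν, z ∈ semiaxes k
  map_rotation : ν.map (fun z => rootOfUnity k * z) = ν

/-- Positive measures: Borel probability measures concentrated on `[0, ∞)`, viewed as measures
on `ℂ` (real line inside the complex plane). -/
structure IsPositiveMeasure (μ : Measure ℂ) : Prop where
  isProbabilityMeasure : IsProbabilityMeasure μ
  ae_nonneg : ∀ᵐ z ∂μ, 0 ≤ z.re ∧ z.im = 0

/-- Bounded support. -/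
def HasBoundedSupport (μ : Measure ℂ) : Prop := ∃ R : ℝ, ∀ᵐ z ∂μ, ‖z‖ ≤ R

/-- Positive measures are the same as `1`-symmetric measures. -/
theorem isKSymmetric_one_iff (μ : Measure ℂ) : IsKSymmetric 1 μ ↔ IsPositiveMeasure μ := by
  have hq : rootOfUnity 1 = 1 := by simp [rootOfUnity]
  have hA : ∀ z : ℂ, z ∈ semiaxes 1 ↔ 0 ≤ z.re ∧ z.im = 0 := by
    intro z
    simp only [semiaxes, hq, one_pow, mul_one, Set.mem_ofPred_eq, exists_const]
    constructor
    · rintro ⟨t, ht, rfl⟩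
      exact ⟨by simpa using ht, by simp⟩
    · rintro ⟨h0, h1⟩
      exact ⟨z.re, h0, Complex.ext (by simp) (by simp [h1])⟩
  constructor
  · rintro ⟨h1, h2, -⟩
    exact ⟨h1, h2.mono fun z hz => (hA z).1 hz⟩
  · rintro ⟨h1, h2⟩
    refine ⟨h1, h2.mono fun z hz => (hA z).2 hz, ?_⟩
    simp [hq]

section NoncommutativeProbability

/- A non-commutative probability space is a unital complex algebra `A` with a linear functional
`φ` such that `φ 1 = 1`. -/

variable {A : Type*} [Ring A] [Algebra ℂ A]

/-- Freeness of a family of unital subalgebras: `φ (a₁ a₂ ⋯ aₙ) = 0` for `n ≥ 1` whenever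
`a_j ∈ S (i_j)`, `φ a_j = 0` and neighbouring indices `i_j` are different. -/
def FreeSubalgebras {ι : Type*} (φ : A →ₗ[ℂ] ℂ) (S : ι → Subalgebra ℂ A) : Prop :=
  ∀ l : List (ι × A), l ≠ [] → l.IsChain (fun p p' => p.1 ≠ p'.1) →
    (∀ p ∈ l, p.2 ∈ S p.1 ∧ φ p.2 = 0) → φ (l.map Prod.snd).prod = 0

/-- Two elements are free if the unital subalgebras that they generate are free. -/
def FreeElements (φ : A →ₗ[ℂ] ℂ) (X Y : A) : Prop :=
  FreeSubalgebras φ (fun i : Bool => Algebra.adjoin ℂ {bif i then X else Y})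

/-- The measure `μ` has all moments, and they are the moments of the element `X`. -/
def HasMoments (φ : A →ₗ[ℂ] ℂ) (X : A) (μ : Measure ℂ) : Prop :=
  ∀ n : ℕ, Integrable (fun z : ℂ => z ^ n) μ ∧ φ (X ^ n) = ∫ z, z ^ n ∂μ

end NoncommutativeProbability

/-- `ρ` is a free multiplicative convolution of `μ` and `ν`: a `k`-symmetric measure with the
moments of `X * Y`, where `X` and `Y` are free elements, with distributions `μ` and `ν`, of some
non-commutative probability space. -/
def IsFreeMulConv (k : ℕ) (μ ν ρ : Measure ℂ) : Prop :=
  IsKSymmetric k ρ ∧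
    ∃ (A : Type) (_ : Ring A) (_ : Algebra ℂ A) (φ : A →ₗ[ℂ] ℂ) (X Y : A),
      φ 1 = 1 ∧ FreeElements φ X Y ∧ HasMoments φ X μ ∧ HasMoments φ Y ν ∧
        HasMoments φ (X * Y) ρ

/-- The free multiplicative convolution `μ ⊠ ν` of a positive measure `μ` and a `k`-symmetric
measure `ν`. For `k = 1` this is the free multiplicative convolution of two positive measures. -/
def freeMulConv (k : ℕ) (μ ν : Measure ℂ) : Measure ℂ :=
  Classical.epsilon (IsFreeMulConv k μ ν)

/-- The free multiplicative powers `μ^{⊠ n}` of a positive measure `μ`. -/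
def freeMulPow (μ : Measure ℂ) : ℕ → Measure ℂ
  | 0 => Measure.dirac 1
  | 1 => μ
  | n + 2 => freeMulConv 1 (freeMulPow μ (n + 1)) μ

/-- The push-forward `ν ^ k` of `ν` under `t ↦ t ^ k`. -/
def powMeasure (k : ℕ) (ν : Measure ℂ) : Measure ℂ := ν.map (fun t => t ^ k)

end

/-! Let σ = μ^{⊠k} ⊠ ν^k, a convolution of positive measures, and let `rootMeasure k σ` be the
`k`-symmetric measure whose push-forward under the `k`-th power is σ (`powMeasure_rootMeasure`).
Everything follows once this measure is recognised as a convolution of μ and ν, and once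
convolutions are known to be unique.

The recognition is a matrix model, `exists_free_weightedShift`. Take free X_0, …, X_{k-1} with
distribution μ and Z with distribution ν^k. On `k × k` matrices, with the expectation of the (0,0)
entry as functional, let D = diag(X_i) and let Y be the cyclic shift with weights 1, …, 1, Z. Powers
of Y and of DY have nonzero diagonal entries only for exponents divisible by `k`; the diagonal of
Y^k consists of Z, and the (0,0) entry of (DY)^k is X_0 ⋯ X_{k-1} Z. Hence D has the moments of μ, Y
those of ν, and DY those of the root of σ. Freeness of D and Y is `FreeSubalgebras.matrix`.

Two inputs remain. First, positive measures can be convolved (`exists_isFreeMulConv_one`). Free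
self-adjoint operators a, b distributed like the square roots of the two measures act on a free
product of ℓ² spaces (`exists_free_isSelfAdjoint`). The vacuum functional lets a move cyclically, so
a²b² has the moments of the positive operator ab²a, whose spectral distribution is the convolution.
Second, uniqueness: moments of free elements determine their joint moments
(`FreeSubalgebras.apply_lift_eq`), and a `k`-symmetric measure with the moments of a boundedly
supported one is equal to it (`IsKSymmetric.eq_of_integral_pow_eq`). -/

/-! ### Centered alternating words and general properties of freeness -/

section CenteredWords

variable {ι κ : Type*} {A B : Type*} [Ring A] [Algebra ℂ A] [Ring B] [Algebra ℂ B]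

/-- Alternating words whose letters are centered elements of the subalgebras `S i`. -/
def IsCenteredWord (φ : A →ₗ[ℂ] ℂ) (S : ι → Subalgebra ℂ A) (l : List (ι × A)) : Prop :=
  l.IsChain (fun p p' => p.1 ≠ p'.1) ∧ ∀ p ∈ l, p.2 ∈ S p.1 ∧ φ p.2 = 0

/-- The span of the products of the centered words whose first index satisfies `P`; the first index
of the empty word, whose product is `1`, is `none`. -/
def wordSpan (φ : A →ₗ[ℂ] ℂ) (S : ι → Subalgebra ℂ A) (P : Option ι → Prop) : Submodule ℂ A :=
  Submodule.span ℂ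
    {a | ∃ l, IsCenteredWord φ S l ∧ P (l.head?.map Prod.fst) ∧ (l.map Prod.snd).prod = a}

variable {φ : A →ₗ[ℂ] ℂ} {S : ι → Subalgebra ℂ A}

theorem isCenteredWord_nil : IsCenteredWord φ S [] := ⟨by simp, by simp⟩

theorem IsCenteredWord.cons {l : List (ι × A)} (hl : IsCenteredWord φ S l) {i : ι} {a : A}
    (ha : a ∈ S i) (h0 : φ a = 0) (hi : l.head?.map Prod.fst ≠ some i) :
    IsCenteredWord φ S ((i, a) :: l) := by
  refine ⟨List.isChain_cons.2 ⟨fun p hp h => hi ?_, hl.1⟩, ?_⟩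
  · have hp' : l.head? = some p := hp
    rw [hp', Option.map_some, ← h]
  · intro p hp
    rcases List.mem_cons.1 hp with rfl | hp
    · exact ⟨ha, h0⟩
    · exact hl.2 p hp

theorem IsCenteredWord.prod_mem {l : List (ι × A)} (hl : IsCenteredWord φ S l)
    {P : Option ι → Prop} (hP : P (l.head?.map Prod.fst)) :
    (l.map Prod.snd).prod ∈ wordSpan φ S P :=
  Submodule.subset_span ⟨l, hl, hP, rfl⟩

theorem wordSpan_mono {P Q : Option ι → Prop} (h : ∀ o, P o → Q o) :
    wordSpan φ S P ≤ wordSpan φ S Q :=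
  Submodule.span_mono fun _ ⟨l, hl, hP, e⟩ => ⟨l, hl, h _ hP, e⟩

theorem one_mem_wordSpan {P : Option ι → Prop} (h : P none) : (1 : A) ∈ wordSpan φ S P :=
  isCenteredWord_nil.prod_mem (l := []) (P := P) h

theorem FreeSubalgebras.eq_zero_of_isCenteredWord (hf : FreeSubalgebras φ S) {l : List (ι × A)}
    (hl : IsCenteredWord φ S l) (hne : l ≠ []) : φ (l.map Prod.snd).prod = 0 :=
  hf l hne hl.1 hl.2

theorem FreeSubalgebras.eq_zero_of_mem_wordSpan (hf : FreeSubalgebras φ S)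
    {P : Option ι → Prop} (hP : ¬ P none) {x : A} (hx : x ∈ wordSpan φ S P) : φ x = 0 := by
  have : wordSpan φ S P ≤ LinearMap.ker φ := by
    refine Submodule.span_le.2 ?_
    rintro _ ⟨l, hl, h, rfl⟩
    refine hf.eq_zero_of_isCenteredWord hl ?_
    rintro rfl
    exact hP h
  exact this hx

theorem mul_mem_wordSpan {i : ι} {a x : A} (ha : a ∈ S i) (h0 : φ a = 0)
    (hx : x ∈ wordSpan φ S (· ≠ some i)) : a * x ∈ wordSpan φ S (· = some i) := by
  have : wordSpan φ S (· ≠ some i) ≤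
      (wordSpan φ S (· = some i)).comap (LinearMap.mulLeft ℂ a) := by
    refine Submodule.span_le.2 ?_
    rintro _ ⟨l, hl, h, rfl⟩
    exact (hl.cons ha h0 h).prod_mem (P := (· = some i)) rfl
  exact this hx

theorem exists_center (h1 : φ 1 = 1) {T : Subalgebra ℂ A} {a : A} (ha : a ∈ T) :
    ∃ b ∈ T, φ b = 0 ∧ a = b + φ a • (1 : A) :=
  ⟨a - φ a • (1 : A), T.sub_mem ha (T.smul_mem T.one_mem _), by simp [h1], by simp⟩

/-- Split the multiplier into a centered part and a scalar. In front of a word not starting in `S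
i`, the centered part is a new letter and the scalar changes nothing. If the word starts in `S i`,
its first letter is absorbed into the multiplier and the rest is of the former kind. -/
theorem mul_mem_wordSpan_true (h1 : φ 1 = 1) {i : ι} {a x : A} (ha : a ∈ S i)
    (hx : x ∈ wordSpan φ S fun _ => True) : a * x ∈ wordSpan φ S fun _ => True := by
  have key : ∀ y ∈ wordSpan φ S (· ≠ some i), ∀ b ∈ S i, b * y ∈ wordSpan φ S fun _ => True := by
    intro y hy b hb
    obtain ⟨c, hc, hc0, hbc⟩ := exists_center h1 hb
    rw [hbc, add_mul, smul_mul_assoc, one_mul]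
    exact add_mem (wordSpan_mono (fun _ _ => trivial) (mul_mem_wordSpan hc hc0 hy))
      (Submodule.smul_mem _ _ (wordSpan_mono (fun _ _ => trivial) hy))
  have : (wordSpan φ S fun _ => True) ≤
      (wordSpan φ S fun _ => True).comap (LinearMap.mulLeft ℂ a) := by
    refine Submodule.span_le.2 ?_
    rintro _ ⟨l, hl, -, rfl⟩
    change a * (l.map Prod.snd).prod ∈ wordSpan φ S fun _ => True
    by_cases h : l.head?.map Prod.fst = some i
    · match l, h, hl with
      | (j, b) :: l, h, hl =>
        obtain rfl : j = i := by simpa using h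
        rw [List.map_cons, List.prod_cons, ← mul_assoc]
        have hc := List.isChain_cons.1 hl.1
        refine key _ (IsCenteredWord.prod_mem ⟨hc.2, fun p hp => hl.2 p (by simp [hp])⟩ ?_) _
          (mul_mem ha (hl.2 (j, b) (by simp)).1)
        intro h'
        obtain ⟨p, hp, hpj⟩ := Option.map_eq_some_iff.1 h'
        exact hc.1 p hp hpj.symm
    · exact key _ (hl.prod_mem h) a ha
  exact this hx

/-- The elements whose left multiplication preserves the span of all words form a subalgebra
containing every `S i`; letting them act on the empty word recovers them. -/
theorem iSup_le_wordSpan (h1 : φ 1 = 1) {x : A} (hx : x ∈ ⨆ i, S i) :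
    x ∈ wordSpan φ S fun _ => True := by
  let T : Subalgebra ℂ A :=
    { carrier := {x | ∀ w ∈ wordSpan φ S fun _ => True, x * w ∈ wordSpan φ S fun _ => True}
      mul_mem' := fun {a b} ha hb w hw => by
        rw [mul_assoc]; exact ha _ (hb _ hw)
      add_mem' := fun {a b} ha hb w hw => by
        rw [add_mul]; exact add_mem (ha _ hw) (hb _ hw)
      algebraMap_mem' := fun r w hw => by
        rw [← Algebra.smul_def]; exact Submodule.smul_mem _ _ hw }
  have hT : (⨆ i, S i) ≤ T := iSup_le fun i a ha w hw => mul_mem_wordSpan_true h1 ha hw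
  simpa using hT hx 1 (one_mem_wordSpan trivial)

/-- Every element of the generated algebra that is centered is a combination of nonempty centered
words. -/
theorem mem_wordSpan_ne_none (h1 : φ 1 = 1) (hf : FreeSubalgebras φ S) {x : A}
    (hx : x ∈ ⨆ i, S i) (h0 : φ x = 0) : x ∈ wordSpan φ S (· ≠ none) := by
  have hle : (wordSpan φ S fun _ => True) ≤
      Submodule.span ℂ {1} ⊔ wordSpan φ S (· ≠ none) := by
    refine Submodule.span_le.2 ?_
    rintro _ ⟨l, hl, -, rfl⟩
    cases l with
    | nil => exact Submodule.mem_sup_left (Submodule.subset_span rfl)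
    | cons p l => exact Submodule.mem_sup_right (hl.prod_mem (by simp))
  obtain ⟨y, hy, z, hz, rfl⟩ := Submodule.mem_sup.1 (hle (iSup_le_wordSpan h1 hx))
  obtain ⟨c, rfl⟩ := Submodule.mem_span_singleton.1 hy
  have hz0 := hf.eq_zero_of_mem_wordSpan (by simp) hz
  have : c = 0 := by simpa [h1, hz0] using h0
  simpa [this] using hz

/-- A functional is determined on the algebra generated by free subalgebras by its restrictions to
these subalgebras. -/
theorem FreeSubalgebras.eq_of_eqOn {ψ : A →ₗ[ℂ] ℂ} (hφ : φ 1 = 1) (hψ : ψ 1 = 1)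
    (hf : FreeSubalgebras φ S) (hg : FreeSubalgebras ψ S)
    (h : ∀ i, ∀ a ∈ S i, φ a = ψ a) {x : A} (hx : x ∈ ⨆ i, S i) : φ x = ψ x := by
  have hle : (wordSpan φ S fun _ => True) ≤ LinearMap.ker (φ - ψ) := by
    refine Submodule.span_le.2 ?_
    rintro _ ⟨l, hl, -, rfl⟩
    rcases eq_or_ne l [] with rfl | hne
    · simp [hφ, hψ]
    · have hl' : IsCenteredWord ψ S l :=
        ⟨hl.1, fun p hp => ⟨(hl.2 p hp).1, by rw [← h p.1 _ (hl.2 p hp).1]; exact (hl.2 p hp).2⟩⟩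
      simp [hf.eq_zero_of_isCenteredWord hl hne, hg.eq_zero_of_isCenteredWord hl' hne]
  simpa [sub_eq_zero] using hle (iSup_le_wordSpan hφ hx)

theorem FreeSubalgebras.mono {T : ι → Subalgebra ℂ A} (hf : FreeSubalgebras φ S)
    (h : ∀ i, T i ≤ S i) : FreeSubalgebras φ T :=
  fun l hne hc hl => hf l hne hc fun p hp => ⟨h _ (hl p hp).1, (hl p hp).2⟩

theorem FreeSubalgebras.comp_injective (hf : FreeSubalgebras φ S) {f : κ → ι}
    (hinj : Function.Injective f) : FreeSubalgebras φ (S ∘ f) := by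
  intro l hne hc hl
  have := hf (l.map fun p => (f p.1, p.2)) (by simpa using hne)
    ((List.isChain_map _).2 (hc.imp fun _ _ h h' => h (hinj h')))
    (by
      intro p hp
      obtain ⟨q, hq, rfl⟩ := List.mem_map.1 hp
      exact hl q hq)
  simpa [List.map_map, Function.comp_def] using this

theorem FreeSubalgebras.comap (g : B →ₐ[ℂ] A) {T : ι → Subalgebra ℂ B}
    (hf : FreeSubalgebras φ S) (h : ∀ i, T i ≤ (S i).comap g) :
    FreeSubalgebras (φ ∘ₗ g.toLinearMap) T := by
  intro l hne hc hl
  have := hf (l.map fun p => (p.1, g p.2)) (by simpa using hne)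
    ((List.isChain_map _).2 hc)
    (by
      intro p hp
      obtain ⟨q, hq, rfl⟩ := List.mem_map.1 hp
      exact ⟨h _ (hl q hq).1, (hl q hq).2⟩)
  simpa [List.map_map, Function.comp_def, map_list_prod] using this

/-- Subalgebras of the algebras generated by disjoint groups of free subalgebras are free. -/
theorem FreeSubalgebras.group (h1 : φ 1 = 1) (hf : FreeSubalgebras φ S) (I : κ → Set ι)
    (hI : Pairwise fun k l => Disjoint (I k) (I l)) {T : κ → Subalgebra ℂ A}
    (hT : ∀ k, T k ≤ ⨆ i : I k, S i) : FreeSubalgebras φ T := by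
  -- Stronger than vanishing: the product expands into centered words for `S` that start in the
  -- group of its first letter.
  suffices H : ∀ l : List (κ × A), IsCenteredWord φ T l → ∀ p, l.head? = some p →
      (l.map Prod.snd).prod ∈ wordSpan φ S fun o => ∃ i ∈ I p.1, o = some i by
    intro l hne hc hl
    cases l with
    | nil => exact absurd rfl hne
    | cons p l =>
      exact hf.eq_zero_of_mem_wordSpan (by simp) (H (p :: l) ⟨hc, hl⟩ p rfl)
  intro l
  induction l with
  | nil => simp
  | cons p l ih =>
    intro hl q hq
    obtain rfl : p = q := by simpa using hq
    have hc := List.isChain_cons.1 hl.1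
    have hl' : IsCenteredWord φ T l := ⟨hc.2, fun p hp => hl.2 p (by simp [hp])⟩
    -- By induction the tail starts in the group of the next letter, which is disjoint from `I p.1`.
    have htail : (l.map Prod.snd).prod ∈ wordSpan φ S fun o => ∀ i ∈ I p.1, o ≠ some i := by
      cases l with
      | nil => exact one_mem_wordSpan (by simp)
      | cons r l =>
        refine wordSpan_mono ?_ (ih hl' r rfl)
        rintro _ ⟨i, hi, rfl⟩ j hj h
        obtain rfl : i = j := by simpa using h
        exact Set.disjoint_left.1 (hI (hc.1 r rfl)) hj hi
    obtain ⟨hp1, hp0⟩ := hl.2 p (by simp)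
    have hp := mem_wordSpan_ne_none h1 (hf.comp_injective (f := ((↑) : I p.1 → ι))
      Subtype.val_injective) (hT _ hp1) hp0
    rw [List.map_cons, List.prod_cons]
    have h2 : ∀ w ∈ wordSpan φ S fun o => ∀ i ∈ I p.1, o ≠ some i,
        wordSpan φ (S ∘ ((↑) : I p.1 → ι)) (· ≠ none) ≤
        (wordSpan φ S fun o => ∃ i ∈ I p.1, o = some i).comap (LinearMap.mulRight ℂ w) := by
      intro w hw
      refine Submodule.span_le.2 ?_
      rintro _ ⟨m, hm, hm0, rfl⟩
      -- The claim is bilinear, so `w` is also reduced to a single word. The concatenation of the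
      -- two words is centered because their indices at the junction differ.
      revert w
      change (wordSpan φ S fun o => ∀ i ∈ I p.1, o ≠ some i) ≤
        (wordSpan φ S fun o => ∃ i ∈ I p.1, o = some i).comap
          (LinearMap.mulLeft ℂ (m.map Prod.snd).prod)
      refine Submodule.span_le.2 ?_
      rintro _ ⟨n, hn, hn0, rfl⟩
      change (m.map Prod.snd).prod * (n.map Prod.snd).prod ∈
        wordSpan φ S fun o => ∃ i ∈ I p.1, o = some i
      have : (m.map Prod.snd).prod * (n.map Prod.snd).prod =
          (((m.map fun p => ((p.1 : ι), p.2)) ++ n).map Prod.snd).prod := by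
        simp [List.map_map, Function.comp_def]
      rw [this]
      refine IsCenteredWord.prod_mem ⟨?_, ?_⟩ ?_
      · refine List.isChain_append.2 ⟨(List.isChain_map _).2
          (hm.1.imp fun _ _ h h' => h (Subtype.ext h')), hn.1, ?_⟩
        intro x hx y hy h
        obtain ⟨x', -, rfl⟩ := List.mem_map.1 (List.mem_of_mem_getLast? hx)
        have hy' : n.head? = some y := hy
        exact hn0 x'.1 x'.1.2 (by rw [hy', Option.map_some, ← h])
      · intro x hx
        rcases List.mem_append.1 hx with hx | hx
        · obtain ⟨x', hx', rfl⟩ := List.mem_map.1 hx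
          exact hm.2 x' hx'
        · exact hn.2 x hx
      · cases m with
        | nil => simp at hm0
        | cons r m => exact ⟨r.1, r.1.2, rfl⟩
    exact h2 _ htail hp

/-- If `φ` is tracial on a free factor, then elements of this factor can be moved cyclically. -/
theorem FreeSubalgebras.apply_mul_comm (h1 : φ 1 = 1) (hf : FreeSubalgebras φ S) {i : ι}
    (htr : ∀ a ∈ S i, ∀ b ∈ S i, φ (a * b) = φ (b * a)) {a x : A} (ha : a ∈ S i)
    (hx : x ∈ ⨆ j, S j) : φ (a * x) = φ (x * a) := by
  obtain ⟨b, hb, hb0, hab⟩ := exists_center h1 ha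
  suffices H : φ (b * x) = φ (x * b) by
    rw [hab, add_mul, mul_add, map_add, map_add, H]
    simp
  have hle : (wordSpan φ S fun _ => True) ≤
      LinearMap.ker (φ ∘ₗ LinearMap.mulLeft ℂ b - φ ∘ₗ LinearMap.mulRight ℂ b) := by
    refine Submodule.span_le.2 ?_
    rintro _ ⟨l, hl, -, rfl⟩
    suffices H : φ (b * (l.map Prod.snd).prod) = φ ((l.map Prod.snd).prod * b) by
      simpa [sub_eq_zero] using H
    -- For words of length at least two both sides vanish: `b` merges with at most the letter next
    -- to it, and a nonempty centered word is left over.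
    by_cases hlen : l.length ≤ 1
    · match l, hlen, hl with
      | [], _, _ => simp
      | [p], _, hl =>
        obtain ⟨hp, hp0⟩ := hl.2 p (by simp)
        by_cases hpi : p.1 = i
        · simpa using htr b hb p.2 (hpi ▸ hp)
        · have e1 := hf.eq_zero_of_isCenteredWord (l := [(i, b), p])
            (hl.cons hb hb0 (by simpa using hpi)) (by simp)
          have e2 := hf.eq_zero_of_isCenteredWord (l := [p, (i, b)])
            (IsCenteredWord.cons (l := [(i, b)]) (i := p.1) (a := p.2)
              (isCenteredWord_nil.cons hb hb0 (by simp)) hp hp0 (by simpa using Ne.symm hpi))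
            (by simp)
          simp only [List.map_cons, List.map_nil, List.prod_cons, List.prod_nil, mul_one] at e1 e2 ⊢
          rw [e1, e2]
    · have hl2 : φ (b * (l.map Prod.snd).prod) = 0 := by
        match l, hlen, hl with
        | [], h, _ => simp at h
        | [_], h, _ => simp at h
        | p :: q :: l, _, hl =>
          have hc := List.isChain_cons.1 hl.1
          obtain ⟨hp, hp0⟩ := hl.2 p (by simp)
          have hl' : IsCenteredWord φ S (q :: l) := ⟨hc.2, fun p hp => hl.2 p (by simp [hp])⟩
          have hpq : p.1 ≠ q.1 := hc.1 q rfl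
          by_cases hpi : p.1 = i
          · obtain ⟨c, hcm, hc0, hbc⟩ := exists_center h1 (mul_mem hb (hpi ▸ hp : p.2 ∈ S i))
            have e1 := hf.eq_zero_of_isCenteredWord
              (hl'.cons hcm hc0 (by simpa [← hpi] using hpq.symm)) (by simp)
            have e2 := hf.eq_zero_of_isCenteredWord hl' (by simp)
            rw [List.map_cons, List.prod_cons] at e1
            rw [List.map_cons, List.prod_cons, ← mul_assoc, hbc, add_mul, map_add, e1,
              smul_mul_assoc, one_mul, map_smul, e2]
            simp
          · have e1 := hf.eq_zero_of_isCenteredWord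
              (hl.cons hb hb0 (by simpa using hpi)) (by simp)
            simpa using e1
      rw [hl2]
      obtain ⟨m, p, rfl⟩ : ∃ m p, l = m ++ [p] :=
        ⟨l.dropLast, l.getLast (by rintro rfl; simp at hlen),
          (List.dropLast_append_getLast _).symm⟩
      obtain ⟨hp, hp0⟩ := hl.2 p (by simp)
      have hc := List.isChain_append.1 hl.1
      have hm : IsCenteredWord φ S m := ⟨hc.1, fun p hp => hl.2 p (by simp [hp])⟩
      have hsnoc : ∀ {m : List (ι × A)}, IsCenteredWord φ S m → ∀ c ∈ S i, φ c = 0 →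
          (∀ q ∈ m.getLast?, q.1 ≠ i) → φ ((m.map Prod.snd).prod * c) = 0 := by
        intro m hm c hcm hc0 hq
        have := hf.eq_zero_of_isCenteredWord (l := m ++ [(i, c)])
          ⟨List.isChain_append.2 ⟨hm.1, by simp, by simpa using hq⟩, fun q hq => by
            rcases List.mem_append.1 hq with hq | hq
            · exact hm.2 q hq
            · obtain rfl : q = (i, c) := by simpa using hq
              exact ⟨hcm, hc0⟩⟩ (by simp)
        simpa using this
      by_cases hpi : p.1 = i
      · obtain ⟨c, hcm, hc0, hbc⟩ := exists_center h1 (mul_mem (hpi ▸ hp : p.2 ∈ S i) hb)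
        have e2 := hf.eq_zero_of_isCenteredWord hm (by rintro rfl; simp at hlen)
        have e1 := hsnoc hm c hcm hc0 (fun q hq h => hc.2.2 q hq p rfl (h.trans hpi.symm))
        rw [List.map_append, List.prod_append, List.map_singleton, List.prod_singleton, mul_assoc,
          hbc, mul_add, map_add, e1, mul_smul_comm, mul_one, map_smul, e2]
        simp
      · exact (hsnoc hl b hb hb0 (by simpa using hpi)).symm
  have := hle (iSup_le_wordSpan h1 hx)
  simpa [sub_eq_zero] using this

end CenteredWords

/-! ### Joint moments of free elements -/

section Universality

variable {ι : Type*} {A B : Type*} [Ring A] [Algebra ℂ A] [Ring B] [Algebra ℂ B]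

theorem linearMap_aeval_eq {φ : A →ₗ[ℂ] ℂ} {ψ : B →ₗ[ℂ] ℂ} {X : A} {Y : B}
    (h : ∀ n : ℕ, φ (X ^ n) = ψ (Y ^ n)) (p : Polynomial ℂ) :
    φ (Polynomial.aeval X p) = ψ (Polynomial.aeval Y p) := by
  simp [Polynomial.aeval_eq_sum_range, h]

/-- Joint moments of free elements are determined by the moments of the individual elements. -/
theorem FreeSubalgebras.apply_lift_eq {φ : A →ₗ[ℂ] ℂ} {ψ : B →ₗ[ℂ] ℂ} (hφ : φ 1 = 1) (hψ : ψ 1 = 1)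
    {X : ι → A} {Y : ι → B} (hX : FreeSubalgebras φ fun i => Algebra.adjoin ℂ {X i})
    (hY : FreeSubalgebras ψ fun i => Algebra.adjoin ℂ {Y i})
    (h : ∀ i, ∀ n : ℕ, φ (X i ^ n) = ψ (Y i ^ n)) (x : FreeAlgebra ℂ ι) :
    φ (FreeAlgebra.lift ℂ X x) = ψ (FreeAlgebra.lift ℂ Y x) := by
  have hle : ∀ {C : Type _} [Ring C] [Algebra ℂ C] (W : ι → C) (i : ι),
      Algebra.adjoin ℂ {FreeAlgebra.ι ℂ i} ≤
        (Algebra.adjoin ℂ {W i}).comap (FreeAlgebra.lift ℂ W) := fun W i =>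
    Algebra.adjoin_le (Set.singleton_subset_iff.2 (by
      simp))
  have hle' : ∀ (i : ι), Algebra.adjoin ℂ {FreeAlgebra.ι ℂ i} ≤
        (Algebra.adjoin ℂ {Y i}).comap (FreeAlgebra.lift ℂ Y) := fun i =>
    Algebra.adjoin_le (Set.singleton_subset_iff.2 (by
      simp))
  -- Pulled back to the free algebra, both functionals make the algebras of the generators free and
  -- agree on each of them.
  refine FreeSubalgebras.eq_of_eqOn (φ := φ ∘ₗ (FreeAlgebra.lift ℂ X).toLinearMap)
    (ψ := ψ ∘ₗ (FreeAlgebra.lift ℂ Y).toLinearMap) (by simp [hφ]) (by simp [hψ])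
    (hX.comap _ (hle X)) (hY.comap _ hle') ?_ (x := x) ?_
  · intro i a ha
    rw [Algebra.adjoin_singleton_eq_range_aeval] at ha
    obtain ⟨p, rfl⟩ := ha
    have := linearMap_aeval_eq (h i) p
    simpa [← Polynomial.aeval_algHom_apply] using this
  · have : (⊤ : Subalgebra ℂ (FreeAlgebra ℂ ι)) ≤
        ⨆ i, Algebra.adjoin ℂ {FreeAlgebra.ι ℂ i} := by
      rw [← FreeAlgebra.adjoin_range_ι]
      refine Algebra.adjoin_le ?_
      rintro _ ⟨i, rfl⟩
      exact le_iSup (fun i => Algebra.adjoin ℂ {FreeAlgebra.ι ℂ i}) i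
        (Algebra.subset_adjoin (Set.mem_singleton _))
    exact this trivial

theorem FreeElements.apply_mul_pow_eq {φ : A →ₗ[ℂ] ℂ} {ψ : B →ₗ[ℂ] ℂ} (hφ : φ 1 = 1)
    (hψ : ψ 1 = 1) {X Y : A} {X' Y' : B} (h : FreeElements φ X Y) (h' : FreeElements ψ X' Y')
    (hX : ∀ n : ℕ, φ (X ^ n) = ψ (X' ^ n)) (hY : ∀ n : ℕ, φ (Y ^ n) = ψ (Y' ^ n)) (n : ℕ) :
    φ ((X * Y) ^ n) = ψ ((X' * Y') ^ n) := by
  have := FreeSubalgebras.apply_lift_eq hφ hψ h h'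
    (fun i n => by cases i; exacts [hY n, hX n])
    ((FreeAlgebra.ι ℂ true * FreeAlgebra.ι ℂ false) ^ n)
  simpa using this

end Universality

/-! ### Freeness of matrices over free algebras -/

section MatrixFreeness

variable {n : Type*} [Fintype n] [DecidableEq n] {A : Type*} [Ring A] [Algebra ℂ A]

/-- If the algebras `S (some j)` and `S none` are free, then diagonal matrices with entries in the
algebras `S (some j)` are free from matrices with entries in `S none`, when the diagonals of all
these matrices consist of entries with the same expectation. -/
theorem FreeSubalgebras.matrix {φ : A →ₗ[ℂ] ℂ} (h1 : φ 1 = 1) {S : Option n → Subalgebra ℂ A}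
    (hf : FreeSubalgebras φ S) (o : n) {T : Bool → Subalgebra ℂ (Matrix n n A)}
    (hT : ∀ b, ∀ M ∈ T b, ∀ i, φ (M i i) = φ (M o o))
    (hdiag : ∀ M ∈ T true, ∀ i j, i ≠ j → M i j = 0)
    (htrue : ∀ M ∈ T true, ∀ i, M i i ∈ S (some i))
    (hfalse : ∀ M ∈ T false, ∀ i j, M i j ∈ S none) :
    FreeSubalgebras (φ ∘ₗ Matrix.entryLinearMap ℂ A o o) T := by
  have hcen : ∀ {b : Bool} {M : Matrix n n A} {l},
      IsCenteredWord (φ ∘ₗ Matrix.entryLinearMap ℂ A o o) T ((b, M) :: l) →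
      M ∈ T b ∧ ∀ i, φ (M i i) = 0 := by
    intro b M l hl
    obtain ⟨hM, hM0⟩ := hl.2 (b, M) (by simp)
    exact ⟨hM, fun i => (hT b M hM i).trans hM0⟩
  have htail : ∀ {p : Bool × Matrix n n A} {l},
      IsCenteredWord (φ ∘ₗ Matrix.entryLinearMap ℂ A o o) T (p :: l) →
      IsCenteredWord (φ ∘ₗ Matrix.entryLinearMap ℂ A o o) T l ∧
        l.head?.map Prod.fst ≠ some p.1 := by
    intro p l hl
    have hc := List.isChain_cons.1 hl.1
    refine ⟨⟨hc.2, fun q hq => hl.2 q (by simp [hq])⟩, fun h => ?_⟩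
    obtain ⟨q, hq, hqp⟩ := Option.map_eq_some_iff.1 h
    exact hc.1 q hq hqp.symm
  have hhead : ∀ {M : Matrix n n A} {l},
      IsCenteredWord (φ ∘ₗ Matrix.entryLinearMap ℂ A o o) T ((false, M) :: l) →
      l = [] ∨ l.head?.map Prod.fst = some true := by
    intro M l hl
    have hne := (htail hl).2
    cases l with
    | nil => exact Or.inl rfl
    | cons q l => exact Or.inr (by simpa using hne)
  -- The first index of an entry is tied to its row: after a leading diagonal factor every word in
  -- row `i` starts in `S (some i)`; otherwise none does.
  have hrow : ∀ l : List (Bool × Matrix n n A),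
      IsCenteredWord (φ ∘ₗ Matrix.entryLinearMap ℂ A o o) T l →
      (l.head?.map Prod.fst = some true →
        ∀ i j, (l.map Prod.snd).prod i j ∈ wordSpan φ S (· = some (some i))) ∧
      (l.head?.map Prod.fst ≠ some true →
        ∀ i j, (l.map Prod.snd).prod i j ∈ wordSpan φ S (· ≠ some (some i))) := by
    intro l
    induction l with
    | nil =>
      refine fun _ => ⟨by simp, fun _ i j => ?_⟩
      by_cases hij : i = j
      · simpa [hij] using one_mem_wordSpan (φ := φ) (S := S) (P := (· ≠ some (some j))) (by simp)
      · simp [hij]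
    | cons p l ih =>
      obtain ⟨b, M⟩ := p
      intro hl
      obtain ⟨hM, hM0⟩ := hcen hl
      obtain ⟨hl', hne⟩ := htail hl
      obtain ⟨iht, ihf⟩ := ih hl'
      have e : (((b, M) :: l).map Prod.snd).prod = M * (l.map Prod.snd).prod := by simp
      rw [e]
      cases b with
      | true =>
        refine ⟨fun _ i j => ?_, by simp⟩
        rw [Matrix.mul_apply]
        refine Submodule.sum_mem _ fun m _ => ?_
        by_cases him : i = m
        · subst him
          exact mul_mem_wordSpan (htrue M hM i) (hM0 i) (ihf hne i j)
        · simp [hdiag M hM i m him]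
      | false =>
        refine ⟨by simp, fun _ i j => ?_⟩
        rcases hhead hl with rfl | hlt
        · obtain ⟨c, hc, hc0, hMc⟩ := exists_center h1 (hfalse M hM i j)
          rw [List.map_nil, List.prod_nil, mul_one, hMc]
          have hcmem := (isCenteredWord_nil.cons hc hc0 (by simp)).prod_mem (φ := φ) (S := S)
            (P := (· = some none)) rfl
          exact add_mem (wordSpan_mono (P := (· = some none)) (by rintro _ rfl; simp)
            (by simpa using hcmem))
            (Submodule.smul_mem _ _ (one_mem_wordSpan (by simp)))
        · rw [Matrix.mul_apply]
          refine Submodule.sum_mem _ fun m _ => ?_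
          obtain ⟨c, hc, hc0, hMc⟩ := exists_center h1 (hfalse M hM i m)
          rw [hMc, add_mul, smul_mul_assoc, one_mul]
          have hR := iht hlt m j
          refine add_mem (wordSpan_mono (by rintro _ rfl; simp)
            (mul_mem_wordSpan hc hc0 (wordSpan_mono (by rintro _ rfl; simp) hR))) ?_
          -- The scalar part of `M i m` multiplies words starting in `S (some m)`. The forbidden
          -- case `m = i` does not arise, since the diagonal entries are centered.
          by_cases him : i = m
          · subst him
            simp [hM0 i]
          · refine Submodule.smul_mem _ _ (wordSpan_mono ?_ hR)
            rintro _ rfl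
            simpa using Ne.symm him
  intro l hne hc hl
  have hl : IsCenteredWord (φ ∘ₗ Matrix.entryLinearMap ℂ A o o) T l := ⟨hc, hl⟩
  change φ ((l.map Prod.snd).prod o o) = 0
  obtain ⟨⟨b, M⟩, l, rfl⟩ := List.exists_cons_of_ne_nil hne
  cases b with
  | true => exact hf.eq_zero_of_mem_wordSpan (by simp) ((hrow _ hl).1 rfl o o)
  | false =>
    obtain ⟨hM, hM0⟩ := hcen hl
    have e : (((false, M) :: l).map Prod.snd).prod = M * (l.map Prod.snd).prod := by simp
    rw [e]
    rcases hhead hl with rfl | hlt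
    · simpa using hM0 o
    -- `hrow` for the whole word would not exclude the empty word, so the first factor is expanded:
    -- every term then starts in `S none` or in some `S (some m)`.
    · rw [Matrix.mul_apply, map_sum]
      refine Finset.sum_eq_zero fun m _ => ?_
      obtain ⟨c, hc, hc0, hMc⟩ := exists_center h1 (hfalse M hM o m)
      have hR := (hrow _ (htail hl).1).1 hlt m o
      rw [hMc, add_mul, smul_mul_assoc, one_mul, map_add, map_smul,
        hf.eq_zero_of_mem_wordSpan (by simp) hR, hf.eq_zero_of_mem_wordSpan (by simp)
          (mul_mem_wordSpan hc hc0 (wordSpan_mono (by rintro _ rfl; simp) hR))]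
      simp

end MatrixFreeness

/-! ### The cyclic weighted shift -/

section WeightedShift

variable {k : ℕ} {A : Type*} [Ring A]

/-- The cyclic weighted shift with weights `w`. -/
def weightedShift (w : ZMod k → A) : Matrix (ZMod k) (ZMod k) A :=
  Matrix.of fun i j => if j = i + 1 then w i else 0

theorem prod_range_mul_period (w : ZMod k → A) (i : ZMod k) (n : ℕ) :
    ((List.range (k * n)).map fun m : ℕ => w (i + m)).prod =
      ((List.range k).map fun m : ℕ => w (i + m)).prod ^ n := by
  induction n with
  | zero => simp
  | succ n ih =>
    rw [mul_add, mul_one, List.range_add, List.map_append, List.prod_append, ih, pow_succ]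
    congr 2
    simp [List.map_map, Function.comp_def]

theorem prod_map_pow (Z : A) (e : ℕ → ℕ) (n : ℕ) :
    ((List.range n).map fun m => Z ^ e m).prod = Z ^ ∑ m ∈ Finset.range n, e m := by
  induction n with
  | zero => simp
  | succ n ih => simp [List.range_succ, ih, Finset.sum_range_succ, pow_add]

variable [NeZero k]

/-- From `i` there is a single path of length `n` along the cycle, and it collects its weights in
order. -/
theorem weightedShift_pow_apply (w : ZMod k → A) (n : ℕ) (i j : ZMod k) :
    (weightedShift w ^ n) i j =
      if j = i + n then ((List.range n).map fun m : ℕ => w (i + m)).prod else 0 := by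
  induction n generalizing j with
  | zero => simp [Matrix.one_apply, eq_comm]
  | succ n ih =>
    rw [pow_succ, Matrix.mul_apply, Finset.sum_eq_single (i + n : ZMod k)]
    · rw [ih, if_pos rfl]
      simp [weightedShift, List.range_succ, add_assoc]
    · intro b _ hb
      rw [ih, if_neg hb, zero_mul]
    · simp

/-- A closed path has length divisible by `k` and winds `n / k` times. This is where the vanishing
moments of a `k`-symmetric distribution come from. -/
theorem weightedShift_pow_apply_self (w : ZMod k → A) (n : ℕ) (i : ZMod k) :
    (weightedShift w ^ n) i i =
      if k ∣ n then ((List.range k).map fun m : ℕ => w (i + m)).prod ^ (n / k) else 0 := by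
  rw [weightedShift_pow_apply]
  by_cases h : k ∣ n
  · obtain ⟨m, rfl⟩ := h
    rw [if_pos (by simp), if_pos (by simp), prod_range_mul_period,
      Nat.mul_div_cancel_left _ (NeZero.pos k)]
  · rw [if_neg h, if_neg]
    simpa [ZMod.natCast_eq_zero_iff] using h

theorem sum_range_period (e : ZMod k → ℕ) (i : ZMod k) :
    ∑ m ∈ Finset.range k, e (i + m) = ∑ x, e x := by
  rw [← Equiv.sum_comp (Equiv.addLeft i) e]
  refine Finset.sum_nbij' (fun m : ℕ => (m : ZMod k)) ZMod.val ?_ ?_ ?_ ?_ ?_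
  · simp
  · intro x _; simpa using ZMod.val_lt x
  · intro m hm; exact ZMod.val_cast_of_lt (by simpa using hm)
  · intro x _; simp
  · simp

variable [Algebra ℂ A]

/-- From free elements `X j`, `Z` with identically distributed `X j`, one gets free elements `D`, `Y`
such that `Y` is `k`-symmetric with `Y ^ k` distributed like `Z`, and `(D * Y) ^ k` is distributed
like the product of all the `X j` and `Z`. -/
theorem exists_free_weightedShift {φ : A →ₗ[ℂ] ℂ} (h1 : φ 1 = 1) (X : ZMod k → A) (Z : A)
    (hf : FreeSubalgebras φ fun o : Option (ZMod k) => Algebra.adjoin ℂ {o.elim Z X})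
    (hX : ∀ j, ∀ n : ℕ, φ (X j ^ n) = φ (X 0 ^ n)) :
    ∃ (ψ : Matrix (ZMod k) (ZMod k) A →ₗ[ℂ] ℂ) (D Y : Matrix (ZMod k) (ZMod k) A),
      ψ 1 = 1 ∧ FreeElements ψ D Y ∧ (∀ n : ℕ, ψ (D ^ n) = φ (X 0 ^ n)) ∧
      (∀ n : ℕ, ψ (Y ^ n) = if k ∣ n then φ (Z ^ (n / k)) else 0) ∧
      ∀ n : ℕ, ψ ((D * Y) ^ n) = if k ∣ n then
        φ ((((List.range k).map fun m : ℕ => X m).prod * Z) ^ (n / k)) else 0 := by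
  -- The only nontrivial weight sits on the edge from `-1` to `0`: each turn meets `Z` once, and the
  -- turn starting at `0` meets it last, after all the `X j`.
  let e : ZMod k → ℕ := fun i => if i = -1 then 1 else 0
  let Y : Matrix (ZMod k) (ZMod k) A := weightedShift fun i => Z ^ e i
  let D : Matrix (ZMod k) (ZMod k) A := Matrix.diagonal X
  have hY : ∀ (n : ℕ) (i : ZMod k), (Y ^ n) i i = if k ∣ n then Z ^ (n / k) else 0 := by
    intro n i
    rw [weightedShift_pow_apply_self, prod_map_pow Z (fun m : ℕ => e (i + m)), sum_range_period]
    simp [e]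
  have hD : ∀ p : Polynomial ℂ,
      Polynomial.aeval D p = Matrix.diagonal fun i => Polynomial.aeval (X i) p := by
    intro p
    induction p using Polynomial.induction_on' with
    | add p q hp hq => simp [hp, hq]
    | monomial n a =>
      simp [D, Polynomial.aeval_monomial, Matrix.diagonal_pow, Matrix.algebraMap_eq_diagonal]
  have hDY : D * Y = weightedShift fun i => X i * Z ^ e i := by
    ext i j
    simp [D, Y, weightedShift]
  have hprod : ((List.range k).map fun m : ℕ => X (0 + m) * Z ^ e (0 + m)).prod =
      ((List.range k).map fun m : ℕ => X m).prod * Z := by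
    obtain ⟨k', rfl⟩ := Nat.exists_eq_succ_of_ne_zero (NeZero.ne k)
    have he : ∀ m < k', e (m : ZMod (k' + 1)) = 0 := by
      intro m hm
      refine if_neg fun h => ?_
      have : ((m + 1 : ℕ) : ZMod (k' + 1)) = 0 := by simp [h]
      rw [ZMod.natCast_eq_zero_iff] at this
      have := Nat.le_of_dvd (by omega) this
      omega
    have he' : e (k' : ZMod (k' + 1)) = 1 := by
      refine if_pos ?_
      have : ((k' + 1 : ℕ) : ZMod (k' + 1)) = 0 := by simp
      push_cast at this
      exact eq_neg_of_add_eq_zero_left this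
    rw [List.range_succ, List.map_append, List.map_append, List.prod_append, List.prod_append]
    simp only [zero_add, List.map_singleton, List.prod_singleton, he', pow_one, mul_assoc]
    congr 2
    refine List.map_congr_left fun m hm => ?_
    rw [he m (by simpa using hm), pow_zero, mul_one]
  refine ⟨φ ∘ₗ Matrix.entryLinearMap ℂ A 0 0, D, Y, by simp [h1], ?_, ?_, ?_, ?_⟩
  · refine FreeSubalgebras.matrix h1 hf 0 ?_ ?_ ?_ ?_
    · intro b M hM i
      rw [Algebra.adjoin_singleton_eq_range_aeval] at hM
      obtain ⟨p, rfl⟩ := hM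
      cases b with
      | true =>
        simpa [hD] using linearMap_aeval_eq (hX i) p
      | false =>
        simp [Polynomial.aeval_eq_sum_range, Matrix.sum_apply, hY]
    · intro M hM i j hij
      rw [Algebra.adjoin_singleton_eq_range_aeval] at hM
      obtain ⟨p, rfl⟩ := hM
      simp [hD, hij]
    · intro M hM i
      rw [Algebra.adjoin_singleton_eq_range_aeval] at hM
      obtain ⟨p, rfl⟩ := hM
      simp [hD, Algebra.adjoin_singleton_eq_range_aeval]
    · intro M hM i j
      rw [Algebra.adjoin_singleton_eq_range_aeval] at hM
      obtain ⟨p, rfl⟩ := hM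
      have hZ : Z ∈ Algebra.adjoin ℂ {Option.elim none Z X} := Algebra.subset_adjoin rfl
      simp only [cond_false, Polynomial.aeval_eq_sum_range, Matrix.sum_apply, RingHom.coe_coe,
        AlgHom.toRingHom_eq_coe]
      refine Subalgebra.sum_mem _ fun m _ => Subalgebra.smul_mem _ ?_ _
      change (Y ^ m) i j ∈ _
      rw [weightedShift_pow_apply]
      split_ifs
      · rw [prod_map_pow Z (fun m : ℕ => e (i + m))]
        exact pow_mem hZ _
      · exact zero_mem _
  · intro n
    simp [D, Matrix.diagonal_pow]
  · intro n
    simp only [LinearMap.comp_apply, Matrix.entryLinearMap_apply, hY]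
    split_ifs <;> simp
  · intro n
    simp only [LinearMap.comp_apply, Matrix.entryLinearMap_apply, hDY]
    rw [weightedShift_pow_apply_self, hprod]
    split_ifs <;> simp

end WeightedShift

/-! ### Amplification of operators on ℓ² spaces -/

section Amplification

open scoped lp InnerProductSpace

variable {W J I : Type*}

theorem lp_hasSum_norm_sq (v : ℓ²(W, ℂ)) : HasSum (fun w => ‖v w‖ ^ 2) (‖v‖ ^ 2) := by
  simpa using lp.hasSum_norm (p := 2) (by simp) v

theorem memℓp_two_of_summable {f : W → ℂ} (h : Summable fun w => ‖f w‖ ^ 2) : Memℓp f 2 :=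
  memℓp_gen (by simpa using h)

/-- The `j`-th slice of a square summable family indexed by `W ≃ J × I`. -/
noncomputable def lpSlice (e : W ≃ J × I) (j : J) : ℓ²(W, ℂ) →ₗ[ℂ] ℓ²(I, ℂ) where
  toFun v := ⟨fun i => v (e.symm (j, i)), memℓp_two_of_summable
    ((lp_hasSum_norm_sq v).summable.comp_injective
      (e.symm.injective.comp (Prod.mk_right_injective j)))⟩
  map_add' _ _ := rfl
  map_smul' _ _ := rfl

theorem lpSlice_apply (e : W ≃ J × I) (j : J) (v : ℓ²(W, ℂ)) (i : I) :
    lpSlice e j v i = v (e.symm (j, i)) := rfl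

theorem lp_ext_slice (e : W ≃ J × I) {v w : ℓ²(W, ℂ)} (h : ∀ j, lpSlice e j v = lpSlice e j w) :
    v = w := by
  ext x
  have := congrArg (fun u : ℓ²(I, ℂ) => u (e x).2) (h (e x).1)
  simpa [lpSlice_apply] using this

theorem hasSum_norm_sq_lpSlice (e : W ≃ J × I) (v : ℓ²(W, ℂ)) :
    HasSum (fun j => ‖lpSlice e j v‖ ^ 2) (‖v‖ ^ 2) :=
  ((e.symm.hasSum_iff).2 (lp_hasSum_norm_sq v)).prod_fiberwise fun j =>
    lp_hasSum_norm_sq (lpSlice e j v)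

theorem hasSum_inner_lpSlice (e : W ≃ J × I) (v w : ℓ²(W, ℂ)) :
    HasSum (fun j => ⟪lpSlice e j v, lpSlice e j w⟫_ℂ) ⟪v, w⟫_ℂ :=
  ((e.symm.hasSum_iff).2 (lp.hasSum_inner v w)).prod_fiberwise fun j =>
    lp.hasSum_inner (lpSlice e j v) (lpSlice e j w)

theorem summable_amplify (e : W ≃ J × I) (T : ℓ²(I, ℂ) →L[ℂ] ℓ²(I, ℂ)) (v : ℓ²(W, ℂ)) :
    Summable fun w => ‖T (lpSlice e (e w).1 v) (e w).2‖ ^ 2 := by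
  have : Summable fun p : J × I => ‖T (lpSlice e p.1 v) p.2‖ ^ 2 := by
    refine (summable_prod_of_nonneg fun p => by positivity).2
      ⟨fun j => (lp_hasSum_norm_sq (T (lpSlice e j v))).summable, ?_⟩
    refine Summable.of_nonneg_of_le (fun j => tsum_nonneg fun i => by positivity) (fun j => ?_)
      ((hasSum_norm_sq_lpSlice e v).summable.mul_left (‖T‖ ^ 2))
    rw [(lp_hasSum_norm_sq (T (lpSlice e j v))).tsum_eq, ← mul_pow]
    exact pow_le_pow_left₀ (norm_nonneg _) (T.le_opNorm _) 2
  exact (e.summable_iff).2 this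

/-- The linear map acting by `T` on all slices. -/
noncomputable def amplifyLinear (e : W ≃ J × I) (T : ℓ²(I, ℂ) →L[ℂ] ℓ²(I, ℂ)) :
    ℓ²(W, ℂ) →ₗ[ℂ] ℓ²(W, ℂ) where
  toFun v := ⟨fun w => T (lpSlice e (e w).1 v) (e w).2,
    memℓp_two_of_summable (summable_amplify e T v)⟩
  map_add' u v := by ext w; simp; rfl
  map_smul' c v := by ext w; simp

theorem lpSlice_amplifyLinear (e : W ≃ J × I) (T : ℓ²(I, ℂ) →L[ℂ] ℓ²(I, ℂ)) (j : J)
    (v : ℓ²(W, ℂ)) : lpSlice e j (amplifyLinear e T v) = T (lpSlice e j v) := by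
  ext i
  simp [lpSlice_apply, amplifyLinear]

theorem norm_amplifyLinear_le (e : W ≃ J × I) (T : ℓ²(I, ℂ) →L[ℂ] ℓ²(I, ℂ)) (v : ℓ²(W, ℂ)) :
    ‖amplifyLinear e T v‖ ≤ ‖T‖ * ‖v‖ := by
  refine le_of_sq_le_sq ?_ (by positivity)
  rw [mul_pow]
  refine hasSum_le (fun j => ?_) (hasSum_norm_sq_lpSlice e (amplifyLinear e T v))
    ((hasSum_norm_sq_lpSlice e v).mul_left (‖T‖ ^ 2))
  rw [lpSlice_amplifyLinear, ← mul_pow]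
  exact pow_le_pow_left₀ (norm_nonneg _) (T.le_opNorm _) 2

/-- The amplification `1 ⊗ T` of an operator `T` on `ℓ²(I)` to `ℓ²(W) = ℓ²(J) ⊗ ℓ²(I)`. -/
noncomputable def amplify (e : W ≃ J × I) :
    (ℓ²(I, ℂ) →L[ℂ] ℓ²(I, ℂ)) →ₐ[ℂ] (ℓ²(W, ℂ) →L[ℂ] ℓ²(W, ℂ)) :=
  AlgHom.ofLinearMap
    { toFun T := (amplifyLinear e T).mkContinuous ‖T‖ (norm_amplifyLinear_le e T)
      map_add' S T := by ext v w; simp [amplifyLinear]; rfl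
      map_smul' c T := by ext v w; simp [amplifyLinear] }
    (by
      ext1 v
      refine lp_ext_slice e fun j => ?_
      exact lpSlice_amplifyLinear e 1 j v)
    (fun S T => by
      ext1 v
      refine lp_ext_slice e fun j => ?_
      change lpSlice e j (amplifyLinear e (S * T) v) =
        lpSlice e j (amplifyLinear e S (amplifyLinear e T v))
      rw [lpSlice_amplifyLinear, lpSlice_amplifyLinear, lpSlice_amplifyLinear]
      rfl)

theorem lpSlice_amplify (e : W ≃ J × I) (T : ℓ²(I, ℂ) →L[ℂ] ℓ²(I, ℂ)) (j : J)
    (v : ℓ²(W, ℂ)) : lpSlice e j (amplify e T v) = T (lpSlice e j v) :=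
  lpSlice_amplifyLinear e T j v

theorem isSelfAdjoint_amplify (e : W ≃ J × I) {T : ℓ²(I, ℂ) →L[ℂ] ℓ²(I, ℂ)}
    (hT : IsSelfAdjoint T) : IsSelfAdjoint (amplify e T) := by
  rw [ContinuousLinearMap.isSelfAdjoint_iff_isSymmetric] at hT ⊢
  intro v w
  have h1 := hasSum_inner_lpSlice e (amplify e T v) w
  have h2 := hasSum_inner_lpSlice e v (amplify e T w)
  simp only [lpSlice_amplify] at h1 h2
  exact h1.unique ((funext fun j => hT _ _ : (fun j => _) = fun j => _) ▸ h2)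

end Amplification

/-! ### The free product of pointed ℓ² spaces -/

section FreeProduct

open scoped lp InnerProductSpace
open Monoid.CoprodI

/-- The vacuum functional `T ↦ ⟪δ_w, T δ_w⟫` on the bounded operators of `ℓ²(W)`. -/
noncomputable def vacuum {W : Type*} [DecidableEq W] (w : W) :
    (ℓ²(W, ℂ) →L[ℂ] ℓ²(W, ℂ)) →ₗ[ℂ] ℂ where
  toFun T := T (lp.single 2 w 1) w
  map_add' _ _ := rfl
  map_smul' _ _ := rfl

theorem vacuum_apply {W : Type*} [DecidableEq W] (w : W) (T : ℓ²(W, ℂ) →L[ℂ] ℓ²(W, ℂ)) :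
    vacuum w T = T (lp.single 2 w 1) w := rfl

theorem vacuum_eq_inner {W : Type*} [DecidableEq W] (w : W) (T : ℓ²(W, ℂ) →L[ℂ] ℓ²(W, ℂ)) :
    vacuum w T = ⟪lp.single 2 w (1 : ℂ), T (lp.single 2 w 1)⟫_ℂ := by
  rw [vacuum_apply, lp.inner_single_left]
  simp

theorem vacuum_one {W : Type*} [DecidableEq W] (w : W) : vacuum w 1 = 1 := by
  simp [vacuum_apply]

variable {ι : Type*} (M : ι → Type*) [∀ i, Monoid (M i)] [DecidableEq ι] [∀ i, DecidableEq (M i)]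

/-- A reduced word consists of a tail not starting in `M i` and a head in `M i`. -/
def Monoid.CoprodI.Word.splitEquiv (i : ι) :
    Word M ≃ {w : Word M // w.fstIdx ≠ some i} × M i where
  toFun w := (⟨(Word.equivPair i w).tail, (Word.equivPair i w).fstIdx_ne⟩, (Word.equivPair i w).head)
  invFun p := (Word.equivPair i).symm ⟨p.2, p.1.1, p.1.2⟩
  left_inv w := (Word.equivPair i).symm_apply_apply w
  right_inv p := by simp

variable {M}

theorem Monoid.CoprodI.Word.splitEquiv_symm_one (i : ι) (w : {w : Word M // w.fstIdx ≠ some i}) :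
    (Word.splitEquiv M i).symm (w, 1) = w.1 := by
  change Word.rcons _ = _
  simp [Word.rcons]

theorem Monoid.CoprodI.Word.fstIdx_splitEquiv_symm (i : ι) (w : {w : Word M // w.fstIdx ≠ some i})
    {m : M i} (hm : m ≠ 1) : ((Word.splitEquiv M i).symm (w, m)).fstIdx = some i := by
  change (Word.rcons _).fstIdx = _
  simp [Word.rcons, hm]

/-- Seen from factor `i`, a vector without components on words starting in `M i` is a multiple of
the vacuum in each slice. -/
theorem lpSlice_eq_of_forall (i : ι) {v : ℓ²(Word M, ℂ)} (hv : ∀ w, w.fstIdx = some i → v w = 0)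
    (j : {w : Word M // w.fstIdx ≠ some i}) :
    lpSlice (Word.splitEquiv M i) j v = v j.1 • lp.single 2 (1 : M i) (1 : ℂ) := by
  ext m
  by_cases hm : m = 1
  · subst hm
    simp [lpSlice_apply, Word.splitEquiv_symm_one]
  · rw [lpSlice_apply, hv _ (Word.fstIdx_splitEquiv_symm i j hm)]
    simp [hm]

theorem vacuum_amplify (i : ι) (T : ℓ²(M i, ℂ) →L[ℂ] ℓ²(M i, ℂ)) :
    vacuum (Word.empty : Word M) (amplify (Word.splitEquiv M i) T) = vacuum (1 : M i) T := by
  have h := lpSlice_amplify (Word.splitEquiv M i) T ⟨Word.empty, by simp [Word.fstIdx, Word.empty]⟩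
    (lp.single 2 Word.empty 1)
  have h0 : ∀ w : Word M, w.fstIdx = some i →
      (lp.single 2 Word.empty 1 : ℓ²(Word M, ℂ)) w = 0 := by
    intro w hw
    refine lp.single_apply_ne 2 _ _ ?_
    rintro rfl
    simp [Word.fstIdx, Word.empty] at hw
  rw [lpSlice_eq_of_forall i h0] at h
  have := congrArg (fun u : ℓ²(M i, ℂ) => u 1) h
  simpa [lpSlice_apply, Word.splitEquiv_symm_one, vacuum_apply] using this

/-- In each slice `T` acts on a multiple of the local vacuum, and the base-point component of the
result is zero because `T` is centered. So a centered operator can only create a letter of `M i`. -/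
theorem amplify_apply_eq_zero {i : ι} {T : ℓ²(M i, ℂ) →L[ℂ] ℓ²(M i, ℂ)}
    (h0 : vacuum (1 : M i) T = 0) {v : ℓ²(Word M, ℂ)} (hv : ∀ w, w.fstIdx = some i → v w = 0)
    {w : Word M} (hw : w.fstIdx ≠ some i) : amplify (Word.splitEquiv M i) T v w = 0 := by
  have h := lpSlice_amplify (Word.splitEquiv M i) T ⟨w, hw⟩ v
  rw [lpSlice_eq_of_forall i hv, map_smul] at h
  have h1 := congrArg (fun u : ℓ²(M i, ℂ) => u 1) h
  rw [vacuum_apply] at h0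
  simpa [lpSlice_apply, Word.splitEquiv_symm_one, h0] using h1

/-- The algebras of operators acting on the factors of a free product are free with respect to the
vacuum state. -/
theorem freeSubalgebras_amplify :
    FreeSubalgebras (vacuum (Word.empty : Word M)) fun i =>
      (amplify (Word.splitEquiv M i)).range := by
  -- A centered product applied to the vacuum is supported on reduced words with the same first
  -- index as the product, so its vacuum coefficient is zero unless the product is empty.
  suffices H : ∀ l : List (ι × (ℓ²(Word M, ℂ) →L[ℂ] ℓ²(Word M, ℂ))),
      IsCenteredWord (vacuum (Word.empty : Word M))
        (fun i => (amplify (Word.splitEquiv M i)).range) l →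
      ∀ w : Word M, w.fstIdx ≠ l.head?.map Prod.fst →
        (l.map Prod.snd).prod (lp.single 2 Word.empty 1) w = 0 by
    intro l hne hc hl
    refine H l ⟨hc, hl⟩ _ ?_
    obtain ⟨p, l, rfl⟩ := List.exists_cons_of_ne_nil hne
    simp [Word.fstIdx, Word.empty]
  intro l
  induction l with
  | nil =>
    intro _ w hw
    refine lp.single_apply_ne 2 _ _ ?_
    rintro rfl
    simp [Word.fstIdx, Word.empty] at hw
  | cons p l ih =>
    obtain ⟨i, a⟩ := p
    intro hl w hw
    have hc := List.isChain_cons.1 hl.1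
    have hl' := ih ⟨hc.2, fun q hq => hl.2 q (List.mem_cons_of_mem _ hq)⟩
    obtain ⟨hT, h0⟩ := hl.2 (i, a) List.mem_cons_self
    obtain ⟨T, rfl⟩ : ∃ T, amplify (Word.splitEquiv M i) T = a := hT
    rw [List.map_cons, List.prod_cons]
    refine amplify_apply_eq_zero ((vacuum_amplify i T).symm.trans h0) (fun w hw => ?_) hw
    refine hl' w fun h => ?_
    rw [hw] at h
    obtain ⟨q, hq, hqp⟩ := Option.map_eq_some_iff.1 h.symm
    exact hc.1 q hq hqp.symm

end FreeProduct

/-! ### Realization of measures by free self-adjoint operators -/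

section MultiplicationOperator

open scoped lp InnerProductSpace ENNReal

theorem HasBoundedSupport.memLp_mul {μ : Measure ℂ} (hb : HasBoundedSupport μ) {f : ℂ → ℂ}
    (hf : MemLp f 2 μ) : MemLp (fun z => z * f z) 2 μ := by
  obtain ⟨R, hR⟩ := hb
  refine hf.of_le_mul (c := R) (aestronglyMeasurable_id.mul hf.1) ?_
  filter_upwards [hR] with z hz
  rw [norm_mul]
  exact mul_le_mul_of_nonneg_right hz (norm_nonneg _)

/-- Multiplication by the variable on `L²(μ)`, for a measure `μ` with bounded support. -/
noncomputable def mulVariable {μ : Measure ℂ} (hb : HasBoundedSupport μ) :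
    Lp ℂ 2 μ →L[ℂ] Lp ℂ 2 μ :=
  LinearMap.mkContinuousOfExistsBound
    { toFun f := (hb.memLp_mul (Lp.memLp f)).toLp _
      map_add' f g := by
        refine Lp.ext ?_
        filter_upwards [MemLp.coeFn_toLp (hb.memLp_mul (Lp.memLp (f + g))),
          MemLp.coeFn_toLp (hb.memLp_mul (Lp.memLp f)),
          MemLp.coeFn_toLp (hb.memLp_mul (Lp.memLp g)), Lp.coeFn_add f g,
          Lp.coeFn_add ((hb.memLp_mul (Lp.memLp f)).toLp _)
            ((hb.memLp_mul (Lp.memLp g)).toLp _)]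
          with z h1 h2 h3 h4 h5
        rw [h1, h5, h4, Pi.add_apply, Pi.add_apply, h2, h3, mul_add]
      map_smul' c f := by
        refine Lp.ext ?_
        filter_upwards [MemLp.coeFn_toLp (hb.memLp_mul (Lp.memLp (c • f))),
          MemLp.coeFn_toLp (hb.memLp_mul (Lp.memLp f)), Lp.coeFn_smul c f,
          Lp.coeFn_smul c ((hb.memLp_mul (Lp.memLp f)).toLp _)]
          with z h1 h2 h3 h4
        rw [h1, RingHom.id_apply, h4, h3, Pi.smul_apply, Pi.smul_apply, h2, smul_eq_mul,
          smul_eq_mul, mul_left_comm] }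
    (by
      obtain ⟨R, hR⟩ := id hb
      refine ⟨R, fun f => Lp.norm_le_mul_norm_of_ae_le_mul ?_⟩
      filter_upwards [MemLp.coeFn_toLp (hb.memLp_mul (Lp.memLp f)), hR] with z h1 h2
      change ‖(hb.memLp_mul (Lp.memLp f)).toLp _ z‖ ≤ _
      rw [h1, norm_mul]
      exact mul_le_mul_of_nonneg_right h2 (norm_nonneg _))

theorem coeFn_mulVariable {μ : Measure ℂ} (hb : HasBoundedSupport μ) (f : Lp ℂ 2 μ) :
    mulVariable hb f =ᵐ[μ] fun z => z * f z :=
  MemLp.coeFn_toLp (hb.memLp_mul (Lp.memLp f))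

theorem isSelfAdjoint_mulVariable {μ : Measure ℂ} (hb : HasBoundedSupport μ)
    (hr : ∀ᵐ z ∂μ, z.im = 0) : IsSelfAdjoint (mulVariable hb) := by
  rw [ContinuousLinearMap.isSelfAdjoint_iff_isSymmetric]
  intro f g
  change ⟪mulVariable hb f, g⟫_ℂ = ⟪f, mulVariable hb g⟫_ℂ
  rw [L2.inner_def, L2.inner_def]
  refine integral_congr_ae ?_
  filter_upwards [coeFn_mulVariable hb f, coeFn_mulVariable hb g, hr] with z h1 h2 h3
  have : (starRingEnd ℂ) z = z := Complex.conj_eq_iff_im.2 h3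
  rw [h1, h2]
  simp [this]
  ring

theorem coeFn_mulVariable_pow {μ : Measure ℂ} [IsFiniteMeasure μ] (hb : HasBoundedSupport μ)
    (n : ℕ) : (mulVariable hb ^ n) (Lp.const 2 μ 1) =ᵐ[μ] fun z => z ^ n := by
  induction n with
  | zero =>
    simp only [pow_zero]
    exact Lp.coeFn_const 2 μ (1 : ℂ)
  | succ n ih =>
    rw [pow_succ']
    filter_upwards [coeFn_mulVariable hb ((mulVariable hb ^ n) (Lp.const 2 μ 1)), ih] with z h1 h2
    rw [pow_succ', ← h2]
    exact h1

theorem inner_mulVariable_pow {μ : Measure ℂ} [IsFiniteMeasure μ] (hb : HasBoundedSupport μ)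
    (n : ℕ) : ⟪Lp.const 2 μ (1 : ℂ), (mulVariable hb ^ n) (Lp.const 2 μ 1)⟫_ℂ = ∫ z, z ^ n ∂μ := by
  rw [L2.inner_def]
  refine integral_congr_ae ?_
  filter_upwards [coeFn_mulVariable_pow hb n, Lp.coeFn_const (p := 2) (μ := μ) (1 : ℂ)] with z h1 h2
  rw [h1, h2]
  simp

open Classical in
/-- Every compactly supported probability measure on the real line is the distribution of a
bounded self-adjoint operator with respect to a vacuum state. -/
theorem exists_isSelfAdjoint_vacuum_pow {μ : Measure ℂ} [IsProbabilityMeasure μ]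
    (hb : HasBoundedSupport μ) (hr : ∀ᵐ z ∂μ, z.im = 0) :
    ∃ (I : Type) (_ : DecidableEq I) (o : I) (T : ℓ²(I, ℂ) →L[ℂ] ℓ²(I, ℂ)), IsSelfAdjoint T ∧
      ∀ n : ℕ, vacuum o (T ^ n) = ∫ z, z ^ n ∂μ := by
  have hnorm : ‖Lp.const 2 μ (1 : ℂ)‖ = 1 := by
    rw [Lp.norm_const' (p := 2) (μ := μ) (c := (1 : ℂ)) (by simp) (by simp)]
    simp
  have hon : Orthonormal ℂ ((↑) : ({Lp.const 2 μ (1 : ℂ)} : Set (Lp ℂ 2 μ)) → Lp ℂ 2 μ) := by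
    refine ⟨fun x => ?_, fun x y h => absurd (Subsingleton.elim x y) h⟩
    rw [Set.mem_singleton_iff.1 x.2, hnorm]
  -- A basis containing the constant function `1` turns the state of L²(μ) into a vacuum state.
  obtain ⟨w, b, hw, hbw⟩ := hon.exists_hilbertBasis_extension
  let o : w := ⟨Lp.const 2 μ 1, hw rfl⟩
  have ho : b.repr (Lp.const 2 μ 1) = lp.single 2 o 1 := by
    rw [← b.repr_self, hbw]
  let T : ℓ²(w, ℂ) →L[ℂ] ℓ²(w, ℂ) :=
    (b.repr.toContinuousLinearEquiv : Lp ℂ 2 μ →L[ℂ] ℓ²(w, ℂ)) ∘L mulVariable hb ∘L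
      (b.repr.symm.toContinuousLinearEquiv : ℓ²(w, ℂ) →L[ℂ] Lp ℂ 2 μ)
  have hT : ∀ v, T v = b.repr (mulVariable hb (b.repr.symm v)) := fun v => rfl
  have hTn : ∀ (n : ℕ) (v), (T ^ n) (b.repr v) = b.repr ((mulVariable hb ^ n) v) := by
    intro n
    induction n with
    | zero => simp
    | succ n ih =>
      intro v
      rw [pow_succ', pow_succ']
      change T ((T ^ n) (b.repr v)) = b.repr (mulVariable hb ((mulVariable hb ^ n) v))
      rw [ih, hT, LinearIsometryEquiv.symm_apply_apply]
  refine ⟨w, inferInstance, o, T, ?_, fun n => ?_⟩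
  · have := (ContinuousLinearMap.isSelfAdjoint_iff_isSymmetric).1 (isSelfAdjoint_mulVariable hb hr)
    rw [ContinuousLinearMap.isSelfAdjoint_iff_isSymmetric]
    intro u v
    have h1 := this (b.repr.symm u) (b.repr.symm v)
    change ⟪b.repr (mulVariable hb (b.repr.symm u)), v⟫_ℂ =
      ⟪u, b.repr (mulVariable hb (b.repr.symm v))⟫_ℂ
    rw [← b.repr.symm.inner_map_map, ← b.repr.symm.inner_map_map u]
    simpa using h1
  · rw [vacuum_eq_inner, ← ho, hTn, b.repr.inner_map_map, inner_mulVariable_pow]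

/-- A pointed type is a monoid: the product of two letters is the first letter different from the
base point. -/
abbrev pointedMonoid {I : Type*} [DecidableEq I] (o : I) : Monoid I where
  mul a b := if a = o then b else a
  one := o
  mul_assoc a b c := by
    change (if (if a = o then b else a) = o then c else (if a = o then b else a)) =
      if a = o then (if b = o then c else b) else a
    split_ifs <;> simp_all
  one_mul a := if_pos rfl
  mul_one a := by
    change (if a = o then o else a) = a
    split_ifs with h
    exacts [h.symm, rfl]

open Classical in
/-- Compactly supported probability measures on the real line are realized by free bounded
self-adjoint operators. -/
theorem exists_free_isSelfAdjoint {ι : Type} (μ : ι → Measure ℂ)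
    (hp : ∀ i, IsProbabilityMeasure (μ i)) (hb : ∀ i, HasBoundedSupport (μ i))
    (hr : ∀ i, ∀ᵐ z ∂μ i, z.im = 0) :
    ∃ (W : Type) (_ : DecidableEq W) (w : W) (a : ι → ℓ²(W, ℂ) →L[ℂ] ℓ²(W, ℂ)), (∀ i, IsSelfAdjoint (a i)) ∧
      FreeSubalgebras (vacuum w) (fun i => Algebra.adjoin ℂ {a i}) ∧
      ∀ i, ∀ n : ℕ, vacuum w (a i ^ n) = ∫ z, z ^ n ∂μ i := by
  choose I hI o T hT hmom using fun i => exists_isSelfAdjoint_vacuum_pow (hb i) (hr i)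
  -- Only the base point matters: reduced words of the coproduct are the alternating words in
  -- letters other than the base points, which index the free product space.
  let _ : ∀ i, Monoid (I i) := fun i => pointedMonoid (o i)
  refine ⟨Monoid.CoprodI.Word I, inferInstance, Monoid.CoprodI.Word.empty,
    fun i => amplify (Monoid.CoprodI.Word.splitEquiv I i) (T i),
    fun i => isSelfAdjoint_amplify _ (hT i), ?_, fun i n => ?_⟩
  · refine FreeSubalgebras.mono (freeSubalgebras_amplify (M := I)) fun i => ?_
    exact Algebra.adjoin_le (Set.singleton_subset_iff.2 ⟨T i, rfl⟩)
  · rw [← map_pow, vacuum_amplify]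
    exact hmom i n

end MultiplicationOperator

/-! ### Spectral distributions of positive operators -/

section SpectralMeasure

open scoped InnerProductSpace CompactlySupported

variable {H : Type*} [NormedAddCommGroup H] [InnerProductSpace ℂ H] [CompleteSpace H]

/-- The distribution of a positive operator with respect to a vector state is a positive measure
with bounded support. -/
theorem exists_isPositiveMeasure_inner_pow {C : H →L[ℂ] H} (hC : 0 ≤ C) {ξ : H} (hξ : ‖ξ‖ = 1) :
    ∃ σ : Measure ℂ, IsPositiveMeasure σ ∧ HasBoundedSupport σ ∧
      ∀ n : ℕ, ⟪ξ, (C ^ n) ξ⟫_ℂ = ∫ z, z ^ n ∂σ := by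
  have hsa : IsSelfAdjoint C := IsSelfAdjoint.of_nonneg hC
  -- The vector state composed with the continuous functional calculus is a positive functional; the
  -- Riesz–Markov theorem turns it into a measure on the spectrum.
  let L : C(spectrum ℝ C, ℝ) →ₗ[ℝ] ℝ :=
    { toFun f := (⟪ξ, cfcHom hsa f ξ⟫_ℂ).re
      map_add' f g := by simp
      map_smul' c f := by simp [inner_smul_right_eq_smul] }
  have hL : ∀ f, 0 ≤ f → 0 ≤ L f := by
    intro f hf
    have h1 : 0 ≤ cfcHom hsa f := cfcHom_nonneg_iff hsa |>.2 hf
    have := ((ContinuousLinearMap.nonneg_iff_isPositive _).1 h1).inner_nonneg_right ξ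
    exact (Complex.nonneg_iff.1 this).1
  let Λ : C_c(spectrum ℝ C, ℝ) →ₚ[ℝ] ℝ := PositiveLinearMap.mk₀
    { toFun f := L f.toContinuousMap
      map_add' f g := L.map_add _ _
      map_smul' c f := L.map_smul c _ }
    (fun f hf => hL _ hf)
  have : CompactSpace (spectrum ℝ C) := isCompact_iff_compactSpace.1 (spectrum.isCompact C)
  let m := RealRMK.rieszMeasure Λ
  have hm : ∀ f : C(spectrum ℝ C, ℝ), ∫ x, f x ∂m = L f := fun f =>
    RealRMK.integral_rieszMeasure Λ (CompactlySupportedContinuousMap.continuousMapEquiv f)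
  have hpow : ∀ n : ℕ, ((∫ x : spectrum ℝ C, (x : ℝ) ^ n ∂m : ℝ) : ℂ) = ⟪ξ, (C ^ n) ξ⟫_ℂ := by
    intro n
    have h1 := hm (((ContinuousMap.id ℝ).restrict (spectrum ℝ C)) ^ n)
    have h2 : (⟪ξ, (C ^ n) ξ⟫_ℂ).im = 0 := by
      have := (ContinuousLinearMap.isSelfAdjoint_iff_isSymmetric).1 (hsa.pow n) ξ ξ
      rw [← Complex.conj_eq_iff_im, inner_conj_symm]
      exact this
    simp only [L, LinearMap.coe_mk, AddHom.coe_mk, map_pow, cfcHom_id] at h1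
    refine Complex.ext ?_ ?_
    · simpa using h1
    · simpa using h2.symm
  have hprob : IsProbabilityMeasure m := by
    have h0 := hpow 0
    have h1 : m.real Set.univ = 1 := by
      simp [inner_self_eq_norm_sq_to_K, hξ] at h0
      exact_mod_cast h0
    exact ⟨by simpa [Measure.real, ENNReal.toReal_eq_one_iff] using h1⟩
  have hmeas : Measurable fun x : spectrum ℝ C => ((x : ℝ) : ℂ) :=
    Complex.measurable_ofReal.comp measurable_subtype_coe
  refine ⟨m.map fun x : spectrum ℝ C => ((x : ℝ) : ℂ), ⟨Measure.isProbabilityMeasure_map hmeas.aemeasurable, ?_⟩,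
    ?_, fun n => ?_⟩
  · refine (ae_map_iff hmeas.aemeasurable ?_).2 (ae_of_all _ fun x => ?_)
    · exact (measurableSet_le measurable_const Complex.measurable_re).inter
        (measurableSet_eq_fun Complex.measurable_im measurable_const)
    · exact ⟨by simpa using spectrum_nonneg_of_nonneg hC x.2, by simp⟩
  · obtain ⟨R, hR⟩ := (spectrum.isCompact (𝕜 := ℝ) C).isBounded.exists_norm_le
    refine ⟨R, (ae_map_iff hmeas.aemeasurable ?_).2 (ae_of_all _ fun x => ?_)⟩
    · exact measurableSet_le measurable_norm measurable_const
    · simpa using hR x.1 x.2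
  · rw [integral_map hmeas.aemeasurable (continuous_pow n).aestronglyMeasurable, ← hpow, ← integral_complex_ofReal]
    simp

end SpectralMeasure

/-! ### The correspondence between `k`-symmetric and positive measures -/

section KSymmetricMeasures

open scoped ENNReal

theorem measurable_pow_complex (k : ℕ) : Measurable fun z : ℂ => z ^ k :=
  measurable_id.pow_const k

theorem rootOfUnity_pow_self {k : ℕ} (hk : 1 ≤ k) : rootOfUnity k ^ k = 1 :=
  (Complex.isPrimitiveRoot_exp k (by omega)).pow_eq_one

theorem isPrimitiveRoot_rootOfUnity {k : ℕ} (hk : 1 ≤ k) : IsPrimitiveRoot (rootOfUnity k) k :=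
  Complex.isPrimitiveRoot_exp k (by omega)

theorem norm_rootOfUnity {k : ℕ} (hk : 1 ≤ k) : ‖rootOfUnity k‖ = 1 :=
  (isPrimitiveRoot_rootOfUnity hk).norm'_eq_one (by omega)

theorem HasBoundedSupport.integrable_pow {μ : Measure ℂ} [IsFiniteMeasure μ]
    (hb : HasBoundedSupport μ) (n : ℕ) : Integrable (fun z : ℂ => z ^ n) μ := by
  obtain ⟨R, hR⟩ := hb
  refine Integrable.of_bound (continuous_pow n).aestronglyMeasurable (R ^ n) ?_
  filter_upwards [hR] with z hz
  rw [norm_pow]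
  exact pow_le_pow_left₀ (norm_nonneg _) hz n

theorem hasBoundedSupport_map {μ : Measure ℂ} (hb : HasBoundedSupport μ) {f : ℂ → ℂ}
    (hf : Measurable f) {g : ℝ → ℝ} (hg : ∀ R z, ‖z‖ ≤ R → ‖f z‖ ≤ g R) :
    HasBoundedSupport (μ.map f) := by
  obtain ⟨R, hR⟩ := hb
  refine ⟨g R, (ae_map_iff hf.aemeasurable (measurableSet_le measurable_norm measurable_const)).2 ?_⟩
  filter_upwards [hR] with z hz using hg R z hz

theorem measurableSet_nonneg : MeasurableSet {z : ℂ | 0 ≤ z.re ∧ z.im = 0} :=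
  (measurableSet_le measurable_const Complex.measurable_re).inter
    (measurableSet_eq_fun Complex.measurable_im measurable_const)

theorem eq_norm_of_nonneg {z : ℂ} (hz : 0 ≤ z.re ∧ z.im = 0) : z = (‖z‖ : ℂ) := by
  have h : z = (z.re : ℂ) := Complex.ext rfl (by simp [hz.2])
  rw [h, Complex.norm_real, Real.norm_of_nonneg hz.1]

theorem isPositiveMeasure_map {μ : Measure ℂ} [IsProbabilityMeasure μ] {f : ℂ → ℂ}
    (hf : Measurable f) (h : ∀ᵐ z ∂μ, 0 ≤ (f z).re ∧ (f z).im = 0) :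
    IsPositiveMeasure (μ.map f) :=
  ⟨Measure.isProbabilityMeasure_map hf.aemeasurable,
    (ae_map_iff hf.aemeasurable measurableSet_nonneg).2 h⟩

/-- The nonnegative `k`-th root of the absolute value. -/
noncomputable def radialRoot (k : ℕ) (w : ℂ) : ℂ := ((‖w‖ ^ ((k : ℝ)⁻¹) : ℝ) : ℂ)

theorem measurable_radialRoot (k : ℕ) : Measurable (radialRoot k) :=
  Complex.measurable_ofReal.comp (measurable_norm.pow_const _)

theorem radialRoot_pow_self {k : ℕ} (hk : 1 ≤ k) (w : ℂ) : radialRoot k w ^ k = (‖w‖ : ℂ) := by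
  rw [radialRoot, ← Complex.ofReal_pow, Real.rpow_inv_natCast_pow (norm_nonneg _) (by omega)]

theorem radialRoot_pow {k : ℕ} (hk : 1 ≤ k) (z : ℂ) : radialRoot k (z ^ k) = (‖z‖ : ℂ) := by
  rw [radialRoot, norm_pow, Real.pow_rpow_inv_natCast (norm_nonneg _) (by omega)]

theorem norm_radialRoot (k : ℕ) (w : ℂ) : ‖radialRoot k w‖ = ‖w‖ ^ ((k : ℝ)⁻¹) := by
  rw [radialRoot, Complex.norm_real, Real.norm_of_nonneg (by positivity)]

/-- The square roots of a positive measure with bounded support. -/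
theorem exists_sqrt_measure {μ : Measure ℂ} (hμ : IsPositiveMeasure μ)
    (hb : HasBoundedSupport μ) : ∃ ν : Measure ℂ, IsPositiveMeasure ν ∧ HasBoundedSupport ν ∧
      ∀ n : ℕ, ∫ z, z ^ (2 * n) ∂ν = ∫ z, z ^ n ∂μ := by
  have := hμ.isProbabilityMeasure
  refine ⟨μ.map (radialRoot 2), isPositiveMeasure_map (measurable_radialRoot 2)
    (ae_of_all _ fun z => ⟨by simp [radialRoot]; positivity, by simp [radialRoot]⟩),
    hasBoundedSupport_map hb (measurable_radialRoot 2) (g := fun R => R ^ (((2 : ℕ) : ℝ)⁻¹))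
      fun R z hz => ?_, fun n => ?_⟩
  · rw [norm_radialRoot]
    gcongr
  · rw [integral_map (measurable_radialRoot 2).aemeasurable
      (continuous_pow _).aestronglyMeasurable]
    refine integral_congr_ae ?_
    filter_upwards [hμ.ae_nonneg] with z hz
    rw [pow_mul, radialRoot_pow_self (by norm_num), ← eq_norm_of_nonneg hz]

/-- Each unit shift trades the term with exponent `t` for the one with exponent `k + t`, and these
agree because `q ^ k = 1`. -/
theorem sum_range_rootOfUnity_mul {k : ℕ} (hk : 1 ≤ k) {M : Type*} [AddCommMonoid M]
    (f : ℂ → M) (t : ℕ) :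
    ∑ s ∈ Finset.range k, f (rootOfUnity k ^ (s + t)) = ∑ s ∈ Finset.range k, f (rootOfUnity k ^ s) := by
  induction t with
  | zero => rfl
  | succ t ih =>
    rw [← ih]
    obtain ⟨k', rfl⟩ := Nat.exists_eq_succ_of_ne_zero (by omega : k ≠ 0)
    rw [Finset.sum_range_succ, Finset.sum_range_succ']
    congr 1
    · refine Finset.sum_congr rfl fun s _ => ?_
      congr 2
      ring
    · congr 1
      rw [show k' + (t + 1) = (k' + 1) + t by ring, pow_add, rootOfUnity_pow_self hk]
      simp

/-- The `k`-symmetric measure whose push-forward under `t ↦ t ^ k` is the positive measure `σ`. -/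
noncomputable def rootMeasure (k : ℕ) (σ : Measure ℂ) : Measure ℂ :=
  (k : ℝ≥0∞)⁻¹ • ∑ s ∈ Finset.range k, σ.map fun w => radialRoot k w * rootOfUnity k ^ s

theorem lintegral_rootMeasure {k : ℕ} (σ : Measure ℂ) {f : ℂ → ℝ≥0∞} (hf : Measurable f) :
    ∫⁻ z, f z ∂rootMeasure k σ =
      (k : ℝ≥0∞)⁻¹ * ∑ s ∈ Finset.range k, ∫⁻ w, f (radialRoot k w * rootOfUnity k ^ s) ∂σ := by
  rw [rootMeasure, lintegral_smul_measure, lintegral_finsetSum_measure, smul_eq_mul]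
  congr 1
  exact Finset.sum_congr rfl fun s _ => lintegral_map hf ((measurable_radialRoot k).mul_const _)

theorem ae_rootMeasure {k : ℕ} {σ : Measure ℂ} {p : ℂ → Prop} (hp : MeasurableSet {z | p z})
    (h : ∀ s, ∀ᵐ w ∂σ, p (radialRoot k w * rootOfUnity k ^ s)) : ∀ᵐ z ∂rootMeasure k σ, p z := by
  refine Measure.ae_smul_measure ?_ _
  rw [ae_finsetSum_measure_iff]
  exact fun s _ => (ae_map_iff ((measurable_radialRoot k).mul_const _).aemeasurable hp).2 (h s)

/-- If `z ^ k` is nonnegative and `z ≠ 0`, then `z / ‖z‖` is a `k`-th root of unity, hence a power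
of `q`. -/
theorem mem_semiaxes_iff {k : ℕ} (hk : 1 ≤ k) (z : ℂ) :
    z ∈ semiaxes k ↔ 0 ≤ (z ^ k).re ∧ (z ^ k).im = 0 := by
  constructor
  · rintro ⟨t, ht, s, rfl⟩
    have : ((t : ℂ) * rootOfUnity k ^ s) ^ k = ((t ^ k : ℝ) : ℂ) := by
      rw [mul_pow, pow_right_comm, rootOfUnity_pow_self hk, one_pow, mul_one, Complex.ofReal_pow]
    rw [this]
    exact ⟨by rw [Complex.ofReal_re]; positivity, Complex.ofReal_im _⟩
  · intro h
    by_cases hz : z = 0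
    · exact ⟨0, le_rfl, 0, by simp [hz]⟩
    have hz' : (‖z‖ : ℂ) ≠ 0 := by simpa using hz
    have h1 : (z / ‖z‖) ^ k = 1 := by
      rw [div_pow, eq_norm_of_nonneg h, norm_pow, Complex.ofReal_pow, div_self (pow_ne_zero _ hz')]
    have : NeZero k := ⟨by omega⟩
    obtain ⟨s, -, hs⟩ := (isPrimitiveRoot_rootOfUnity hk).eq_pow_of_pow_eq_one h1
    exact ⟨‖z‖, norm_nonneg _, s, by rw [hs, mul_div_cancel₀ _ hz']⟩

theorem measurableSet_semiaxes {k : ℕ} (hk : 1 ≤ k) : MeasurableSet (semiaxes k) := by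
  have : semiaxes k = (fun z : ℂ => z ^ k) ⁻¹' {z : ℂ | 0 ≤ z.re ∧ z.im = 0} :=
    Set.ext (mem_semiaxes_iff hk)
  rw [this]
  exact (measurable_pow_complex k) measurableSet_nonneg

theorem isKSymmetric_rootMeasure {k : ℕ} (hk : 1 ≤ k) (σ : Measure ℂ) [IsProbabilityMeasure σ] :
    IsKSymmetric k (rootMeasure k σ) := by
  have hk0 : (k : ℝ≥0∞) ≠ 0 := by simpa using Nat.one_le_iff_ne_zero.1 hk
  refine ⟨⟨?_⟩, ae_rootMeasure (measurableSet_semiaxes hk) fun s => ae_of_all _ fun w => ?_, ?_⟩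
  · have := lintegral_rootMeasure (k := k) σ (f := fun _ => 1) measurable_const
    simpa [ENNReal.inv_mul_cancel hk0] using this
  · exact ⟨_, by positivity, s, rfl⟩
  · have hm : Measurable fun z : ℂ => rootOfUnity k * z := measurable_const_mul _
    refine Measure.ext_of_lintegral _ fun f hf => ?_
    rw [lintegral_map hf hm, lintegral_rootMeasure σ (show Measurable fun z => f (rootOfUnity k * z) from hf.comp hm),
      lintegral_rootMeasure σ hf,
      ← sum_range_rootOfUnity_mul hk (fun x => ∫⁻ w, f (radialRoot k w * x) ∂σ) 1]
    congr 2
    ext s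
    refine lintegral_congr fun w => ?_
    rw [pow_succ]
    congr 1
    ring

theorem HasBoundedSupport.rootMeasure {k : ℕ} (hk : 1 ≤ k) {σ : Measure ℂ}
    (hb : HasBoundedSupport σ) : HasBoundedSupport (rootMeasure k σ) := by
  obtain ⟨R, hR⟩ := hb
  refine ⟨R ^ ((k : ℝ)⁻¹), ae_rootMeasure (measurableSet_le measurable_norm measurable_const)
    fun s => ?_⟩
  filter_upwards [hR] with w hw
  rw [norm_mul, norm_radialRoot, norm_pow, norm_rootOfUnity hk, one_pow, mul_one]
  gcongr

theorem powMeasure_rootMeasure {k : ℕ} (hk : 1 ≤ k) {σ : Measure ℂ} (hσ : IsPositiveMeasure σ) :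
    powMeasure k (rootMeasure k σ) = σ := by
  have hk0 : (k : ℝ≥0∞) ≠ 0 := by simpa using Nat.one_le_iff_ne_zero.1 hk
  have hm : Measurable fun z : ℂ => z ^ k := measurable_pow_complex k
  refine Measure.ext_of_lintegral _ fun f hf => ?_
  rw [powMeasure, lintegral_map hf hm,
    lintegral_rootMeasure σ (show Measurable fun z => f (z ^ k) from hf.comp hm)]
  have : ∀ s ∈ Finset.range k,
      ∫⁻ w, f ((radialRoot k w * rootOfUnity k ^ s) ^ k) ∂σ = ∫⁻ w, f w ∂σ := by
    intro s _
    refine lintegral_congr_ae ?_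
    filter_upwards [hσ.ae_nonneg] with w hw
    rw [mul_pow, radialRoot_pow_self hk, pow_right_comm,
      rootOfUnity_pow_self hk, one_pow, mul_one, ← eq_norm_of_nonneg hw]
  rw [Finset.sum_congr rfl this, Finset.sum_const, Finset.card_range, nsmul_eq_mul, ← mul_assoc,
    ENNReal.inv_mul_cancel hk0 (by simp), one_mul]

theorem IsKSymmetric.map_mul_rootOfUnity_pow {k : ℕ} {ρ : Measure ℂ} (hρ : IsKSymmetric k ρ)
    (s : ℕ) : ρ.map (fun z => z * rootOfUnity k ^ s) = ρ := by
  induction s with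
  | zero => simp
  | succ s ih =>
    have : (fun z : ℂ => z * rootOfUnity k ^ (s + 1)) =
        (fun z => rootOfUnity k * z) ∘ fun z => z * rootOfUnity k ^ s := by
      ext z
      simp only [Function.comp_apply]
      ring
    rw [this, ← Measure.map_map (measurable_const_mul _) (measurable_mul_const _), ih,
      hρ.map_rotation]

/-- On the semiaxes the `k` rotations of `‖z‖` are the `k` rotations of `z`, and by invariance every
rotation gives the same integral. A `k`-symmetric measure is thus recovered from its push-forward.
-/
theorem IsKSymmetric.rootMeasure_powMeasure {k : ℕ} (hk : 1 ≤ k) {ρ : Measure ℂ}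
    (hρ : IsKSymmetric k ρ) : rootMeasure k (powMeasure k ρ) = ρ := by
  have hk0 : (k : ℝ≥0∞) ≠ 0 := by simpa using Nat.one_le_iff_ne_zero.1 hk
  have hm : Measurable fun z : ℂ => z ^ k := measurable_pow_complex k
  refine Measure.ext_of_lintegral _ fun f hf => ?_
  have h1 : ∀ s, Measurable fun w => f (radialRoot k w * rootOfUnity k ^ s) := fun s =>
    hf.comp ((measurable_radialRoot k).mul_const _)
  have h2 : ∀ s, Measurable fun z => f (z * rootOfUnity k ^ s) := fun s =>
    hf.comp (measurable_mul_const _)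
  rw [lintegral_rootMeasure _ hf]
  have e1 : ∑ s ∈ Finset.range k,
      ∫⁻ w, f (radialRoot k w * rootOfUnity k ^ s) ∂(powMeasure k ρ) =
      ∑ s ∈ Finset.range k, ∫⁻ z, f (z * rootOfUnity k ^ s) ∂ρ := by
    have e2 : ∀ s ∈ Finset.range k,
        ∫⁻ w, f (radialRoot k w * rootOfUnity k ^ s) ∂(powMeasure k ρ) =
        ∫⁻ z, f (radialRoot k (z ^ k) * rootOfUnity k ^ s) ∂ρ := fun s _ => by
      rw [powMeasure, lintegral_map (h1 s) hm]
    rw [Finset.sum_congr rfl e2, ← lintegral_finsetSum _ fun s _ =>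
        (show Measurable fun z => f (radialRoot k (z ^ k) * rootOfUnity k ^ s) from (h1 s).comp hm),
      ← lintegral_finsetSum _ fun s _ => h2 s]
    refine lintegral_congr_ae ?_
    filter_upwards [hρ.ae_mem_semiaxes] with z hz
    obtain ⟨t, ht, s, rfl⟩ := hz
    have hn : ‖(t : ℂ) * rootOfUnity k ^ s‖ = t := by
      rw [norm_mul, norm_pow, norm_rootOfUnity hk, one_pow, mul_one, Complex.norm_real,
        Real.norm_of_nonneg ht]
    rw [radialRoot_pow hk, hn, ← sum_range_rootOfUnity_mul hk (fun x => f (t * x)) s]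
    refine Finset.sum_congr rfl fun r _ => ?_
    rw [mul_assoc, ← pow_add, add_comm]
  have e3 : ∀ s ∈ Finset.range k, ∫⁻ z, f (z * rootOfUnity k ^ s) ∂ρ = ∫⁻ z, f z ∂ρ := by
    intro s _
    conv_rhs => rw [← hρ.map_mul_rootOfUnity_pow s]
    rw [lintegral_map hf (measurable_mul_const _)]
  rw [e1, Finset.sum_congr rfl e3, Finset.sum_const, Finset.card_range, nsmul_eq_mul, ← mul_assoc,
    ENNReal.inv_mul_cancel hk0 (by simp), one_mul]

theorem IsKSymmetric.isPositiveMeasure_powMeasure {k : ℕ} (hk : 1 ≤ k) {ρ : Measure ℂ}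
    (hρ : IsKSymmetric k ρ) : IsPositiveMeasure (powMeasure k ρ) := by
  have := hρ.isProbabilityMeasure
  exact isPositiveMeasure_map (measurable_pow_complex k)
    (hρ.ae_mem_semiaxes.mono fun z hz => (mem_semiaxes_iff hk z).1 hz)

theorem HasBoundedSupport.powMeasure {ρ : Measure ℂ} (hb : HasBoundedSupport ρ) (k : ℕ) :
    HasBoundedSupport (powMeasure k ρ) :=
  hasBoundedSupport_map hb (measurable_pow_complex k) (g := fun R => R ^ k) fun R z hz => by
    rw [norm_pow]
    gcongr

/-- Invariance multiplies the `n`-th moment by `q ^ n`, which differs from `1` unless `k ∣ n`. -/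
theorem IsKSymmetric.integral_pow {k : ℕ} (hk : 1 ≤ k) {ρ : Measure ℂ} (hρ : IsKSymmetric k ρ)
    (n : ℕ) : ∫ z, z ^ n ∂ρ = if k ∣ n then ∫ z, z ^ (n / k) ∂(powMeasure k ρ) else 0 := by
  split_ifs with h
  · obtain ⟨m, rfl⟩ := h
    rw [powMeasure, integral_map (measurable_pow_complex k).aemeasurable
      (continuous_pow _).aestronglyMeasurable, Nat.mul_div_cancel_left _ (by omega)]
    simp [pow_mul]
  · have h1 : ∫ z, z ^ n ∂ρ = rootOfUnity k ^ n * ∫ z, z ^ n ∂ρ := by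
      conv_lhs => rw [← hρ.map_rotation]
      rw [integral_map (measurable_const_mul _).aemeasurable
        (continuous_pow _).aestronglyMeasurable, ← integral_const_mul]
      simp [mul_pow]
    have h2 : rootOfUnity k ^ n ≠ 1 := fun e =>
      h ((isPrimitiveRoot_rootOfUnity hk).dvd_of_pow_eq_one n e)
    by_contra h0
    exact h2 (mul_right_cancel₀ h0 (by rw [← h1, one_mul]))

end KSymmetricMeasures

/-! ### Determinacy of the moment problem -/

section MomentDeterminacy

theorem IsPositiveMeasure.integral_norm_pow {σ : Measure ℂ} (hσ : IsPositiveMeasure σ) (n : ℕ) :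
    ((∫ z, ‖z‖ ^ n ∂σ : ℝ) : ℂ) = ∫ z, z ^ n ∂σ := by
  rw [← integral_complex_ofReal]
  refine integral_congr_ae ?_
  filter_upwards [hσ.ae_nonneg] with z hz
  rw [Complex.ofReal_pow, ← eq_norm_of_nonneg hz]

/-- Markov's inequality for `‖z‖ ^ n` bounds the mass beyond `R + 1` by `(R / (R + 1)) ^ n`, which
tends to zero. Uniqueness needs this because a competing measure is not assumed to have bounded
support. -/
theorem IsPositiveMeasure.hasBoundedSupport_of_integral_pow_eq {σ τ : Measure ℂ}
    (hσ : IsPositiveMeasure σ) (hτ : IsPositiveMeasure τ) (hb : HasBoundedSupport τ)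
    (hint : ∀ n : ℕ, Integrable (fun z : ℂ => z ^ n) σ)
    (h : ∀ n : ℕ, ∫ z, z ^ n ∂σ = ∫ z, z ^ n ∂τ) : HasBoundedSupport σ := by
  have := hσ.isProbabilityMeasure
  have := hτ.isProbabilityMeasure
  obtain ⟨R', hR'⟩ := hb
  set R := max R' 1 with hRdef
  have hR1 : 1 ≤ R := le_max_right _ _
  have hR : ∀ᵐ z ∂τ, ‖z‖ ≤ R := hR'.mono fun z hz => hz.trans (le_max_left _ _)
  have hnorm : ∀ n : ℕ, ∫ z, ‖z‖ ^ n ∂σ = ∫ z, ‖z‖ ^ n ∂τ := fun n => by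
    have := (hσ.integral_norm_pow n).trans ((h n).trans (hτ.integral_norm_pow n).symm)
    exact_mod_cast this
  have hle : ∀ n : ℕ, ∫ z, ‖z‖ ^ n ∂τ ≤ R ^ n := fun n => by
    have : ∫ z, ‖z‖ ^ n ∂τ ≤ ∫ _, R ^ n ∂τ := by
      refine integral_mono_of_nonneg (ae_of_all _ fun z => by positivity) (integrable_const _) ?_
      filter_upwards [hR] with z hz
      gcongr
    simpa using this
  have hmark : ∀ n : ℕ, σ.real {z | R + 1 ≤ ‖z‖} ≤ (R / (R + 1)) ^ n := by
    intro n
    have h1 := mul_meas_ge_le_integral_of_nonneg (μ := σ) (f := fun z => ‖z‖ ^ n)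
      (ae_of_all _ fun z => by positivity) (by simpa [norm_pow] using (hint n).norm) ((R + 1) ^ n)
    have h2 : σ.real {z | R + 1 ≤ ‖z‖} ≤ σ.real {z | (R + 1) ^ n ≤ ‖z‖ ^ n} :=
      measureReal_mono fun z (hz : R + 1 ≤ ‖z‖) => pow_le_pow_left₀ (by linarith) hz n
    rw [div_pow, le_div_iff₀ (by positivity), mul_comm]
    calc (R + 1) ^ n * σ.real {z | R + 1 ≤ ‖z‖}
        ≤ (R + 1) ^ n * σ.real {z | (R + 1) ^ n ≤ ‖z‖ ^ n} := by gcongr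
      _ ≤ ∫ z, ‖z‖ ^ n ∂σ := h1
      _ ≤ R ^ n := (hnorm n).trans_le (hle n)
  have hzero : σ.real {z | R + 1 ≤ ‖z‖} ≤ 0 :=
    ge_of_tendsto' (tendsto_pow_atTop_nhds_zero_of_lt_one (by positivity)
      ((div_lt_one (by linarith)).2 (by linarith))) hmark
  have hnull : σ {z | R + 1 ≤ ‖z‖} = 0 :=
    (measureReal_eq_zero_iff).1 (le_antisymm hzero measureReal_nonneg)
  refine ⟨R + 1, ?_⟩
  have : ∀ᵐ z ∂σ, ¬ (R + 1 ≤ ‖z‖) := measure_eq_zero_iff_ae_notMem.1 hnull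
  exact this.mono fun z hz => (not_le.1 hz).le

/-- A positive measure with bounded support is determined by its moments. -/
theorem IsPositiveMeasure.eq_of_integral_pow_eq {σ τ : Measure ℂ}
    (hσ : IsPositiveMeasure σ) (hτ : IsPositiveMeasure τ) (hb : HasBoundedSupport τ)
    (hint : ∀ n : ℕ, Integrable (fun z : ℂ => z ^ n) σ)
    (h : ∀ n : ℕ, ∫ z, z ^ n ∂σ = ∫ z, z ^ n ∂τ) : σ = τ := by
  have := hσ.isProbabilityMeasure
  have := hτ.isProbabilityMeasure
  have hbσ := hσ.hasBoundedSupport_of_integral_pow_eq hτ hb hint h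
  obtain ⟨R₁, hR₁⟩ := hb
  obtain ⟨R₂, hR₂⟩ := id hbσ
  set R := max R₁ R₂
  have hpoly : ∀ p : Polynomial ℝ, ∫ z, p.eval ‖z‖ ∂σ = ∫ z, p.eval ‖z‖ ∂τ := by
    intro p
    have hn : ∀ (m : Measure ℂ) (_ : IsPositiveMeasure m), HasBoundedSupport m →
        ∀ n : ℕ, Integrable (fun z : ℂ => ‖z‖ ^ n) m := fun m hm hbm n => by
      have := hm.isProbabilityMeasure
      simpa [norm_pow] using (hbm.integrable_pow n).norm
    simp only [Polynomial.eval_eq_sum_range]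
    rw [integral_finsetSum _ fun i _ => (hn σ hσ hbσ i).const_mul _,
      integral_finsetSum _ fun i _ => (hn τ hτ ⟨R₁, hR₁⟩ i).const_mul _]
    refine Finset.sum_congr rfl fun i _ => ?_
    rw [integral_const_mul, integral_const_mul]
    congr 1
    have := (hσ.integral_norm_pow i).trans ((h i).trans (hτ.integral_norm_pow i).symm)
    exact_mod_cast this
  -- Only the values of `f` on `[0, R]` matter, where `z = ‖z‖`, and there the Weierstrass theorem
  -- applies.
  have happrox : ∀ (m : Measure ℂ) (_ : IsPositiveMeasure m) (_ : ∀ᵐ z ∂m, ‖z‖ ≤ R)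
      (f : BoundedContinuousFunction ℂ ℝ) (p : Polynomial ℝ) (ε : ℝ),
      (∀ x ∈ Set.Icc 0 R, |p.eval x - f (x : ℂ)| < ε) →
      |∫ z, p.eval ‖z‖ ∂m - ∫ z, f z ∂m| ≤ ε := by
    intro m hm hR f p ε hp
    have := hm.isProbabilityMeasure
    have hclose : ∀ᵐ z ∂m, ‖p.eval ‖z‖ - f z‖ ≤ ε := by
      filter_upwards [hR, hm.ae_nonneg] with z hz h0
      have := (hp ‖z‖ ⟨norm_nonneg _, hz⟩).le
      rwa [← eq_norm_of_nonneg h0] at this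
    have hfi : Integrable f m := f.integrable m
    have hpi : Integrable (fun z : ℂ => p.eval ‖z‖) m := by
      have hd : Integrable (fun z : ℂ => p.eval ‖z‖ - f z) m :=
        Integrable.of_bound ((p.continuous.comp continuous_norm).sub f.continuous).aestronglyMeasurable
          ε hclose
      exact (hd.add hfi).congr (ae_of_all _ fun z => by simp)
    rw [← integral_sub hpi hfi]
    simpa using norm_integral_le_of_norm_le_const hclose
  refine ext_of_forall_integral_eq_of_IsFiniteMeasure fun f => ?_
  refine eq_of_forall_dist_le fun ε hε => ?_
  obtain ⟨p, hp⟩ := exists_polynomial_near_of_continuousOn 0 R (fun x => f (x : ℂ))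
    (f.continuous.comp Complex.continuous_ofReal).continuousOn (ε / 2) (by positivity)
  have h1 := happrox σ hσ (hR₂.mono fun z hz => hz.trans (le_max_right _ _)) f p _ hp
  have h2 := happrox τ hτ (hR₁.mono fun z hz => hz.trans (le_max_left _ _)) f p _ hp
  rw [hpoly p] at h1
  rw [Real.dist_eq]
  rw [abs_le] at h1 h2 ⊢
  constructor <;> linarith

/-- A `k`-symmetric measure with bounded support is determined by its moments. -/
theorem IsKSymmetric.eq_of_integral_pow_eq {k : ℕ} (hk : 1 ≤ k) {ρ ρ' : Measure ℂ}
    (hρ : IsKSymmetric k ρ) (hρ' : IsKSymmetric k ρ') (hb : HasBoundedSupport ρ')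
    (hint : ∀ n : ℕ, Integrable (fun z : ℂ => z ^ n) ρ)
    (h : ∀ n : ℕ, ∫ z, z ^ n ∂ρ = ∫ z, z ^ n ∂ρ') : ρ = ρ' := by
  rw [← hρ.rootMeasure_powMeasure hk, ← hρ'.rootMeasure_powMeasure hk]
  congr 1
  refine IsPositiveMeasure.eq_of_integral_pow_eq (hρ.isPositiveMeasure_powMeasure hk)
    (hρ'.isPositiveMeasure_powMeasure hk) (hb.powMeasure k) (fun n => ?_) fun n => ?_
  · refine (integrable_map_measure (continuous_pow n).aestronglyMeasurable
      (measurable_pow_complex k).aemeasurable).2 ?_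
    simpa [Function.comp_def, ← pow_mul] using hint (k * n)
  · have h1 := h (k * n)
    rw [hρ.integral_pow hk, hρ'.integral_pow hk] at h1
    simpa [Nat.mul_div_cancel_left n (by omega : 0 < k)] using h1

end MomentDeterminacy

/-! ### Existence and uniqueness of the convolution -/

section FreeMultiplicativeConvolution

open scoped lp InnerProductSpace

theorem FreeSubalgebras.freeElements_list_prod {ι : Type*} {A : Type*} [Ring A] [Algebra ℂ A]
    {φ : A →ₗ[ℂ] ℂ} (h1 : φ 1 = 1) {X : ι → A}
    (hf : FreeSubalgebras φ fun i => Algebra.adjoin ℂ {X i}) {l : List ι} {j : ι} (hj : j ∉ l) :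
    FreeElements φ (l.map X).prod (X j) := by
  refine hf.group h1 (fun b : Bool => {i | bif b then i ∈ l else i = j}) ?_ ?_
  · intro a b hab
    rw [Set.disjoint_left]
    cases a <;> cases b <;> simp at hab ⊢
    · exact hj
    · intro i hi h
      exact hj (h ▸ hi)
  · intro b
    refine Algebra.adjoin_le (Set.singleton_subset_iff.2 ?_)
    cases b with
    | true =>
      refine Subalgebra.list_prod_mem _ fun x hx => ?_
      obtain ⟨i, hi, rfl⟩ := List.mem_map.1 hx
      exact le_iSup (fun i : {i | i ∈ l} => Algebra.adjoin ℂ {X i}) ⟨i, hi⟩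
        (Algebra.subset_adjoin rfl)
    | false =>
      exact le_iSup (fun i : {i | i = j} => Algebra.adjoin ℂ {X i}) ⟨j, rfl⟩
        (Algebra.subset_adjoin rfl)

theorem FreeSubalgebras.freeElements_of_mem {A : Type*} [Ring A] [Algebra ℂ A] {φ : A →ₗ[ℂ] ℂ}
    {S : Bool → Subalgebra ℂ A} (hf : FreeSubalgebras φ S) {X Y : A} (hX : X ∈ S true)
    (hY : Y ∈ S false) : FreeElements φ X Y := by
  refine hf.mono fun b => Algebra.adjoin_le (Set.singleton_subset_iff.2 ?_)
  cases b
  exacts [hY, hX]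

theorem mul_comm_of_mem_adjoin_singleton {A : Type*} [Ring A] [Algebra ℂ A] {a x y : A}
    (hx : x ∈ Algebra.adjoin ℂ {a}) (hy : y ∈ Algebra.adjoin ℂ {a}) : x * y = y * x := by
  rw [Algebra.adjoin_singleton_eq_range_aeval] at hx hy
  obtain ⟨p, rfl⟩ := hx
  obtain ⟨q, rfl⟩ := hy
  exact (map_mul (Polynomial.aeval a) p q).symm.trans
    ((congrArg _ (mul_comm p q)).trans (map_mul (Polynomial.aeval a) q p))

/-- The two powers differ by moving one factor `a` from the front to the back, so traciality on the
factor containing `a` is enough. -/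
theorem FreeSubalgebras.apply_sq_mul_pow {ι : Type*} {A : Type*} [Ring A] [Algebra ℂ A]
    {φ : A →ₗ[ℂ] ℂ} (h1 : φ 1 = 1) {S : ι → Subalgebra ℂ A} (hf : FreeSubalgebras φ S) {i : ι}
    (htr : ∀ a ∈ S i, ∀ b ∈ S i, φ (a * b) = φ (b * a)) {a b : A} (ha : a ∈ S i)
    (hb : b ∈ ⨆ j, S j) (n : ℕ) : φ ((a ^ 2 * b) ^ n) = φ ((a * b * a) ^ n) := by
  cases n with
  | zero => simp
  | succ n =>
    have ha' : a ∈ ⨆ j, S j := le_iSup S i ha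
    have hcomm := hf.apply_mul_comm h1 htr ha (x := (a * b * a) ^ n * (a * b))
      (mul_mem (pow_mem (mul_mem (mul_mem ha' hb) ha') n) (mul_mem ha' hb))
    have e1 : a * ((a * b * a) ^ n * (a * b)) = (a ^ 2 * b) ^ (n + 1) := by
      rw [← mul_assoc, ← mul_pow_mul, mul_assoc, pow_succ _ n]
      simp only [sq, mul_assoc]
    have e2 : (a * b * a) ^ n * (a * b) * a = (a * b * a) ^ (n + 1) := by
      rw [mul_assoc, pow_succ _ n]
    rw [← e1, hcomm, e2]

theorem HasMoments.of_hasBoundedSupport {A : Type*} [Ring A] [Algebra ℂ A] {φ : A →ₗ[ℂ] ℂ} {X : A}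
    {μ : Measure ℂ} [IsFiniteMeasure μ] (hb : HasBoundedSupport μ)
    (h : ∀ n : ℕ, φ (X ^ n) = ∫ z, z ^ n ∂μ) : HasMoments φ X μ :=
  fun n => ⟨hb.integrable_pow n, h n⟩

section

variable {k : ℕ} {μ ν ρ : Measure ℂ}

theorem IsFreeMulConv.hasMoments_mul (h : IsFreeMulConv k μ ν ρ) {A : Type*} [Ring A] [Algebra ℂ A]
    {φ : A →ₗ[ℂ] ℂ} {X Y : A} (h1 : φ 1 = 1) (hf : FreeElements φ X Y) (hX : HasMoments φ X μ)
    (hY : HasMoments φ Y ν) : HasMoments φ (X * Y) ρ := by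
  obtain ⟨-, B, _, _, ψ, X', Y', h1', hf', hX', hY', hXY'⟩ := h
  intro n
  refine ⟨(hXY' n).1, ?_⟩
  rw [← (hXY' n).2]
  exact hf.apply_mul_pow_eq h1 h1' hf' (fun n => (hX n).2.trans (hX' n).2.symm)
    (fun n => (hY n).2.trans (hY' n).2.symm) n

theorem IsFreeMulConv.eq_of_hasMoments_mul (hk : 1 ≤ k) (h : IsFreeMulConv k μ ν ρ)
    (hb : HasBoundedSupport ρ) {A : Type*} [Ring A] [Algebra ℂ A]
    {φ : A →ₗ[ℂ] ℂ} {X Y : A} (h1 : φ 1 = 1) (hf : FreeElements φ X Y) (hX : HasMoments φ X μ)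
    (hY : HasMoments φ Y ν) {ρ' : Measure ℂ} (hρ' : IsKSymmetric k ρ')
    (hXY : HasMoments φ (X * Y) ρ') : ρ' = ρ :=
  hρ'.eq_of_integral_pow_eq hk h.1 hb (fun n => (hXY n).1) fun n =>
    (hXY n).2.symm.trans (h.hasMoments_mul h1 hf hX hY n).2

theorem IsFreeMulConv.eq (hk : 1 ≤ k) (h : IsFreeMulConv k μ ν ρ) (hb : HasBoundedSupport ρ)
    {ρ' : Measure ℂ} (h' : IsFreeMulConv k μ ν ρ') : ρ' = ρ := by
  obtain ⟨hρ', B, _, _, ψ, X', Y', h1', hf', hX', hY', hXY'⟩ := h'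
  exact h.eq_of_hasMoments_mul hk hb h1' hf' hX' hY' hρ' hXY'

/-- `freeMulConv` is an epsilon choice, so any boundedly supported convolution, once exhibited, must
be the chosen one. -/
theorem IsFreeMulConv.freeMulConv_eq (hk : 1 ≤ k) (h : IsFreeMulConv k μ ν ρ)
    (hb : HasBoundedSupport ρ) : freeMulConv k μ ν = ρ :=
  h.eq hk hb (Classical.epsilon_spec ⟨ρ, h⟩)

end

/-- The free multiplicative convolution of positive measures with bounded support exists, and it is
a positive measure with bounded support. -/
theorem exists_isFreeMulConv_one {μ ν : Measure ℂ} (hμ : IsPositiveMeasure μ)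
    (hμb : HasBoundedSupport μ) (hν : IsPositiveMeasure ν) (hνb : HasBoundedSupport ν) :
    ∃ σ, IsPositiveMeasure σ ∧ HasBoundedSupport σ ∧ IsFreeMulConv 1 μ ν σ := by
  -- With square roots `a`, `b` available, the product `a²b²` can be replaced by the positive
  -- operator `ab²a`.
  obtain ⟨μ', hμ', hμb', hμm⟩ := exists_sqrt_measure hμ hμb
  obtain ⟨ν', hν', hνb', hνm⟩ := exists_sqrt_measure hν hνb
  obtain ⟨W, _, w, a, hsa, hf, hmom⟩ := exists_free_isSelfAdjoint
    (fun b : Bool => bif b then μ' else ν')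
    (by rintro (_ | _); exacts [hν'.isProbabilityMeasure, hμ'.isProbabilityMeasure])
    (by rintro (_ | _); exacts [hνb', hμb'])
    (by rintro (_ | _); exacts [hν'.ae_nonneg.mono fun _ h => h.2,
      hμ'.ae_nonneg.mono fun _ h => h.2])
  have h1 : vacuum w 1 = 1 := vacuum_one w
  have hC : 0 ≤ a true * (a false) ^ 2 * a true := by
    have := star_mul_self_nonneg (a false * a true)
    rwa [star_mul, (hsa true).star_eq, (hsa false).star_eq, mul_assoc, ← mul_assoc (a false),
      ← sq, ← mul_assoc] at this
  have hξ : ‖(lp.single 2 w 1 : ℓ²(W, ℂ))‖ = 1 := by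
    rw [lp.norm_single (by simp)]
    simp
  obtain ⟨σ, hσ, hσb, hσm⟩ := exists_isPositiveMeasure_inner_pow hC hξ
  have hmem : ∀ b, a b ∈ Algebra.adjoin ℂ {a b} := fun b => Algebra.subset_adjoin rfl
  have hcyc := hf.apply_sq_mul_pow h1 (i := true)
    (fun x hx y hy => by rw [mul_comm_of_mem_adjoin_singleton hx hy]) (hmem true)
    (pow_mem (le_iSup (fun i => Algebra.adjoin ℂ {a i}) false (hmem false)) 2)
  have := hμ.isProbabilityMeasure
  have := hν.isProbabilityMeasure
  have := hσ.isProbabilityMeasure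
  refine ⟨σ, hσ, hσb, (isKSymmetric_one_iff σ).2 hσ, _, _, _, vacuum w, a true ^ 2, a false ^ 2, h1,
    ?_, HasMoments.of_hasBoundedSupport hμb fun n => ?_,
    HasMoments.of_hasBoundedSupport hνb fun n => ?_,
    HasMoments.of_hasBoundedSupport hσb fun n => ?_⟩
  · exact hf.freeElements_of_mem (pow_mem (hmem true) 2) (pow_mem (hmem false) 2)
  · rw [← pow_mul]
    exact (hmom true _).trans (hμm n)
  · rw [← pow_mul]
    exact (hmom false _).trans (hνm n)
  · rw [hcyc, vacuum_eq_inner, hσm]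

theorem isFreeMulConv_one_freeMulConv {μ ν : Measure ℂ} (hμ : IsPositiveMeasure μ)
    (hμb : HasBoundedSupport μ) (hν : IsPositiveMeasure ν) (hνb : HasBoundedSupport ν) :
    IsPositiveMeasure (freeMulConv 1 μ ν) ∧ HasBoundedSupport (freeMulConv 1 μ ν) ∧
      IsFreeMulConv 1 μ ν (freeMulConv 1 μ ν) := by
  obtain ⟨σ, hσ, hσb, h⟩ := exists_isFreeMulConv_one hμ hμb hν hνb
  rw [h.freeMulConv_eq le_rfl hσb]
  exact ⟨hσ, hσb, h⟩

theorem isPositiveMeasure_freeMulPow {μ : Measure ℂ} (hμ : IsPositiveMeasure μ)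
    (hμb : HasBoundedSupport μ) (n : ℕ) :
    IsPositiveMeasure (freeMulPow μ (n + 1)) ∧ HasBoundedSupport (freeMulPow μ (n + 1)) := by
  induction n with
  | zero => exact ⟨hμ, hμb⟩
  | succ n ih =>
    have := isFreeMulConv_one_freeMulConv ih.1 ih.2 hμ hμb
    exact ⟨this.1, this.2.1⟩

/-- A product of free elements with distribution `μ` is distributed like a free power of `μ`. -/
theorem hasMoments_list_prod {ι : Type*} {A : Type*} [Ring A] [Algebra ℂ A] {φ : A →ₗ[ℂ] ℂ}
    (h1 : φ 1 = 1) {X : ι → A} (hf : FreeSubalgebras φ fun i => Algebra.adjoin ℂ {X i})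
    {μ : Measure ℂ} (hμ : IsPositiveMeasure μ) (hμb : HasBoundedSupport μ) (f : ℕ → ι) (n : ℕ)
    (hinj : Set.InjOn f (Set.Iic n)) (hX : ∀ m ≤ n, HasMoments φ (X (f m)) μ) :
    HasMoments φ (((List.range (n + 1)).map f).map X).prod (freeMulPow μ (n + 1)) := by
  induction n with
  | zero => simpa [freeMulPow] using hX 0 le_rfl
  | succ n ih =>
    have ih := ih (hinj.mono (Set.Iic_subset_Iic.2 (Nat.le_succ n)))
      fun m hm => hX m (hm.trans (Nat.le_succ n))
    have hp := isPositiveMeasure_freeMulPow hμ hμb n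
    have hfree : FreeElements φ (((List.range (n + 1)).map f).map X).prod (X (f (n + 1))) := by
      refine hf.freeElements_list_prod h1 fun hmem => ?_
      obtain ⟨m, hm, hmn⟩ := List.mem_map.1 hmem
      rw [List.mem_range] at hm
      have := hinj (Set.mem_Iic.2 (by omega : m ≤ n + 1)) (Set.mem_Iic.2 le_rfl) hmn
      omega
    rw [List.range_succ, List.map_append, List.map_append, List.prod_append]
    simpa [freeMulPow] using (isFreeMulConv_one_freeMulConv hp.1 hp.2 hμ hμb).2.2.hasMoments_mul h1 hfree ih
      (hX (n + 1) le_rfl)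

/-- The `k`-symmetric root of `μ^{⊠ k} ⊠ ν^k` is a free multiplicative convolution of `μ` and `ν`. -/
theorem isFreeMulConv_rootMeasure {k : ℕ} (hk : 1 ≤ k) {μ ν : Measure ℂ} (hμ : IsPositiveMeasure μ)
    (hμb : HasBoundedSupport μ) (hν : IsKSymmetric k ν) (hνb : HasBoundedSupport ν) :
    IsFreeMulConv k μ ν (rootMeasure k (freeMulConv 1 (freeMulPow μ k) (powMeasure k ν))) := by
  obtain ⟨n, rfl⟩ := Nat.exists_eq_succ_of_ne_zero (by omega : k ≠ 0)
  have hpow := isPositiveMeasure_freeMulPow hμ hμb n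
  have hνp := hν.isPositiveMeasure_powMeasure hk
  have hνpb := hνb.powMeasure (n + 1)
  obtain ⟨hσ, hσb, hconv⟩ := isFreeMulConv_one_freeMulConv hpow.1 hpow.2 hνp hνpb
  set σ := freeMulConv 1 (freeMulPow μ (n + 1)) (powMeasure (n + 1) ν)
  have := hμ.isProbabilityMeasure
  have := hν.isProbabilityMeasure
  have := hνp.isProbabilityMeasure
  have := hσ.isProbabilityMeasure
  -- The index `none` carries the push-forward of ν, and the `n + 1` other indices carry copies of
  -- μ.
  obtain ⟨W, _, w, a, -, hf, hmom⟩ := exists_free_isSelfAdjoint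
    (fun o : Option (ZMod (n + 1)) => o.elim (powMeasure (n + 1) ν) fun _ => μ)
    (by rintro (_ | _); exacts [hνp.isProbabilityMeasure, hμ.isProbabilityMeasure])
    (by rintro (_ | _); exacts [hνpb, hμb])
    (by rintro (_ | _); exacts [hνp.ae_nonneg.mono fun _ h => h.2,
      hμ.ae_nonneg.mono fun _ h => h.2])
  have h1 : vacuum w 1 = 1 := vacuum_one w
  have hZ : HasMoments (vacuum w) (a none) (powMeasure (n + 1) ν) :=
    HasMoments.of_hasBoundedSupport hνpb (hmom none)
  have hX : ∀ j, HasMoments (vacuum w) (a (some j)) μ := fun j =>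
    HasMoments.of_hasBoundedSupport hμb (hmom (some j))
  have hprod := hasMoments_list_prod h1 hf hμ hμb (fun m : ℕ => some (m : ZMod (n + 1))) n
    (fun x hx y hy hxy => by
      have := congrArg ZMod.val (Option.some.inj hxy)
      rwa [ZMod.val_cast_of_lt (Nat.lt_succ_of_le hx),
        ZMod.val_cast_of_lt (Nat.lt_succ_of_le hy)] at this)
    (fun m _ => hX m)
  have hfree := hf.freeElements_list_prod h1 (j := none)
    (l := (List.range (n + 1)).map fun m : ℕ => some (m : ZMod (n + 1))) (by simp)
  have hPZ := hconv.hasMoments_mul h1 hfree hprod hZ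
  have hf' : FreeSubalgebras (vacuum w) fun o : Option (ZMod (n + 1)) =>
      Algebra.adjoin ℂ {o.elim (a none) fun j => a (some j)} := by
    convert hf using 4 with o
    cases o <;> rfl
  obtain ⟨ψ, D, Y, hψ1, hDY, hD, hY, hDYm⟩ := exists_free_weightedShift h1 (fun j => a (some j))
    (a none) hf' fun j m => ((hX j m).2.trans (hX 0 m).2.symm)
  have hρ := isKSymmetric_rootMeasure hk σ
  have := hρ.isProbabilityMeasure
  refine ⟨hρ, _, _, _, ψ, D, Y, hψ1, hDY, HasMoments.of_hasBoundedSupport hμb fun m => ?_,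
    HasMoments.of_hasBoundedSupport hνb fun m => ?_,
    HasMoments.of_hasBoundedSupport (hσb.rootMeasure hk) fun m => ?_⟩
  · rw [hD, (hX 0 m).2]
  · rw [hY, hν.integral_pow hk, (hZ _).2]
  · rw [hDYm, hρ.integral_pow hk, powMeasure_rootMeasure hk hσ]
    have := (hPZ (m / (n + 1))).2
    rw [List.map_map] at this
    rw [← this]
    rfl

end FreeMultiplicativeConvolution

theorem mainTheorem5 (k : ℕ) (hk : 1 ≤ k) (μ ν : Measure ℂ)
    (hμ : IsPositiveMeasure μ) (hμb : HasBoundedSupport μ)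
    (hν : IsKSymmetric k ν) (hνb : HasBoundedSupport ν) :
    (∃! ρ : Measure ℂ, IsFreeMulConv k μ ν ρ) ∧
    IsKSymmetric k (freeMulConv k μ ν) ∧
    HasBoundedSupport (freeMulConv k μ ν) ∧
    (∀ (A : Type*) [Ring A] [Algebra ℂ A] (φ : A →ₗ[ℂ] ℂ) (X Y : A), φ 1 = 1 →
      FreeElements φ X Y → HasMoments φ X μ → HasMoments φ Y ν →
      ∀ ρ : Measure ℂ, IsKSymmetric k ρ →
        (HasMoments φ (X * Y) ρ ↔ ρ = freeMulConv k μ ν)) ∧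
    powMeasure k (freeMulConv k μ ν) =
      freeMulConv 1 (freeMulPow μ k) (powMeasure k ν) := by
  obtain ⟨n, rfl⟩ := Nat.exists_eq_succ_of_ne_zero (by omega : k ≠ 0)
  have hpow := isPositiveMeasure_freeMulPow hμ hμb n
  obtain ⟨hσ, hσb, -⟩ := isFreeMulConv_one_freeMulConv hpow.1 hpow.2
    (hν.isPositiveMeasure_powMeasure hk) (hνb.powMeasure (n + 1))
  have hconv := isFreeMulConv_rootMeasure hk hμ hμb hν hνb
  have hb := hσb.rootMeasure hk
  rw [hconv.freeMulConv_eq hk hb]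
  refine ⟨⟨_, hconv, fun ρ h => hconv.eq hk hb h⟩, hconv.1, hb, ?_, powMeasure_rootMeasure hk hσ⟩
  intro A _ _ φ X Y h1 hf hX hY ρ hρ
  refine ⟨fun h => hconv.eq_of_hasMoments_mul hk hb h1 hf hX hY hρ h, ?_⟩
  rintro rfl
  exact hconv.hasMoments_mul h1 hf hX hY
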